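/- Let $\Sigma_{1,1}$ be the once-punctured torus, whose fundamental group is free of rank $2$, and fix a base point and a pair $(a,b)$ of generators of $\pi_1(\Sigma_{1,1})$. A free homotopy class of oriented closed curves on $\Sigma_{1,1}$ (equivalently, a conjugacy class of $\pi_1(\Sigma_{1,1})$; classes of loops around the puncture are included) is called primitive if it is not an $n$-th power of a class for any $n\ge 2$. It has word length $L$ if it can be represented by a word $x_1\cdots x_L$ in the letters $a,b,a^{-1},b^{-1}$ that is cyclically reduced, that is, $x_{i+1}\ne x_i^{-1}$ for $1\le i<L$ and $x_1\neq x_L^{-1}$. There are exactly $4$ primitive free homotopy classes of word length $1$ and exactly $4$ of word length $2$. For every integer $L\ge 3$, the number of primitive free homotopy classes of word length $L$ is $$\frac1L\sum_{d\mid L}\mu(d)\,3^{L/d},$$ where $\mu$ is the Möbius function. For every integer $L\ge 1$, the number of all (not necessarily primitive) free homotopy classes of word length $L$ is $$\frac1L\sum_{d\mid L}\varphi(d)\,3^{L/d}+\frac{3+(-1)^L}{2},$$ where $\varphi$ is Euler's totient function. -/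

import Mathlib

noncomputable section

/-- The once-punctured torus: the torus `(ℝ / ℤ) × (ℝ / ℤ)` with the point `0` removed. -/
abbrev PuncturedTorus : Type :=
  {p : UnitAddCircle × UnitAddCircle // p ≠ 0}

section FreeHomotopy

variable (X : Type*) [TopologicalSpace X]

/-- Oriented closed curves on `X` are continuous maps `ℝ / ℤ → X`; two of them are equivalent if
they are freely homotopic, that is, homotopic without any condition on base points. -/
def freeHomotopySetoid : Setoid C(UnitAddCircle, X) :=
  ⟨ContinuousMap.Homotopic, ContinuousMap.Homotopic.equivalence⟩

/-- The free homotopy classes of oriented closed curves on `X`. -/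
def FreeHomotopyClass : Type _ :=
  Quotient (freeHomotopySetoid X)

end FreeHomotopy

/-- The map `t ↦ n t` of the circle `ℝ / ℤ` to itself. -/
def circlePow (n : ℕ) : C(UnitAddCircle, UnitAddCircle) :=
  ⟨fun t => n • t, continuous_const_smul n⟩

namespace FreeHomotopyClass

variable {X : Type*} [TopologicalSpace X]

/-- The free homotopy class of a closed curve. -/
def mk (c : C(UnitAddCircle, X)) : FreeHomotopyClass X :=
  Quotient.mk (freeHomotopySetoid X) c

/-- The `n`-th power of a free homotopy class: a curve in the class is run through `n` times. -/
def pow (γ : FreeHomotopyClass X) (n : ℕ) : FreeHomotopyClass X :=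
  Quotient.map (sa := freeHomotopySetoid X) (sb := freeHomotopySetoid X)
    (fun c : C(UnitAddCircle, X) => c.comp (circlePow n))
    (fun _ _ h => ContinuousMap.Homotopic.comp h (ContinuousMap.Homotopic.refl _)) γ

/-- A free homotopy class is primitive if it is not a proper power of another class. -/
def IsPrimitive (γ : FreeHomotopyClass X) : Prop :=
  ¬ ∃ (δ : FreeHomotopyClass X) (n : ℕ), 2 ≤ n ∧ γ = δ.pow n

end FreeHomotopyClass

section WordLength

variable {X : Type*} [TopologicalSpace X]

/-- A closed curve with `c 0 = x`, seen as a loop `t ↦ c t`, `0 ≤ t ≤ 1`, based at `x`. -/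
def loopOfCurve {x : X} (c : C(UnitAddCircle, X)) (hc : c 0 = x) : Path x x where
  toFun t := c ((t : ℝ) : UnitAddCircle)
  continuous_toFun := c.continuous.comp
    ((AddCircle.continuous_mk' (1 : ℝ)).comp continuous_subtype_val)
  source' := by simpa using hc
  target' := by
    have h : (((1 : unitInterval) : ℝ) : UnitAddCircle) = 0 := AddCircle.coe_period (1 : ℝ)
    rw [h, hc]

/-- The free homotopy class `γ` is represented by the element `g` of the fundamental group:
some curve in `γ` passes through `x` at time `0`, and as a loop based at `x` it has class `g`. -/
def FreeHomotopyClass.IsRepresentedBy {x : X} (γ : FreeHomotopyClass X)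
    (g : FundamentalGroup X x) : Prop :=
  ∃ (c : C(UnitAddCircle, X)) (hc : c 0 = x), FreeHomotopyClass.mk c = γ ∧
    FundamentalGroup.fromPath (Path.Homotopic.Quotient.mk (loopOfCurve c hc)) = g

/-- The value in the fundamental group of a word in the letters `a, b, a⁻¹, b⁻¹`: the letters
`(0, true)`, `(0, false)`, `(1, true)`, `(1, false)` stand for `a`, `a⁻¹`, `b`, `b⁻¹`. -/
def wordValue {x : X} (a b : FundamentalGroup X x) (w : List (Fin 2 × Bool)) :
    FundamentalGroup X x :=
  FreeGroup.lift ![a, b] (FreeGroup.mk w)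

/-- `γ` has word length `n` with respect to `a, b`: it can be represented by a word of `n` letters
in `a, b, a⁻¹, b⁻¹` in which no two adjacent letters are inverse to each other, the last letter
and the first one counting as adjacent. -/
def FreeHomotopyClass.HasWordLength {x : X} (a b : FundamentalGroup X x)
    (γ : FreeHomotopyClass X) (n : ℕ) : Prop :=
  ∃ w : List (Fin 2 × Bool), FreeGroup.IsCyclicallyReduced w ∧ w.length = n ∧
    γ.IsRepresentedBy (wordValue a b w)

end WordLength

end

/-! Free homotopy classes that meet the base point are conjugacy classes of the fundamental group,
and powers of classes correspond to powers of group elements (`ofFundamentalGroup_eq_iff`,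
`ofFundamentalGroup_isPrimitive_iff`).

That the given generators `a`, `b` are free is proved without computing the fundamental group. A
path-connected principal bundle with discrete fibre `FreeGroup (Fin 2)` gives a surjection from the
fundamental group onto the free group of rank 2 (`exists_surjective_fundamentalGroup_freeGroup`).
Composed with the surjection `lift ![a, b]`, it is a surjective endomorphism of that free group,
hence injective by the Hopf property; so `lift ![a, b]` is bijective
(`lift_bijective_of_closure_eq_top`).

In a free group, cyclically reduced words are conjugate exactly when they are rotations of each
other (`IsCyclicallyReduced.isConj_mk_iff`). A nonempty cyclically reduced word of length `L` is an
`L`-periodic point of the shift on infinite reduced sequences, rotation is the shift, and the class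
is primitive exactly when the minimal period is `L`. So the classes are shift orbits. The shift has
`3 ^ n + 2 + (-1) ^ n` points of period `n`, the trace of the `n`-th power of a 4 × 4 matrix. Möbius
inversion counts the orbits of size `L`, and convolution with the totient counts all orbits of size
dividing `L`. The terms `2 + (-1) ^ n` contribute nothing to the Möbius sum once `L ≥ 3`, and
contribute `(3 + (-1) ^ L) / 2` to the totient count. -/

noncomputable section

open Topology unitInterval

/-! ### Free homotopy classes and conjugacy classes of the fundamental group. -/

section FreeHomotopy

variable {X : Type*} [TopologicalSpace X]

/-- The closed curve that runs through a loop. -/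
def curveOfLoop {x : X} (p : Path x x) : C(UnitAddCircle, X) where
  toFun := AddCircle.liftIco (1 : ℝ) 0 p.extend
  continuous_toFun := AddCircle.liftIco_zero_continuous (by simp) p.continuous_extend.continuousOn

theorem curveOfLoop_coe {x : X} (p : Path x x) {t : ℝ} (ht : t ∈ I) :
    curveOfLoop p (t : UnitAddCircle) = p ⟨t, ht⟩ := by
  rcases ht.2.lt_or_eq with h | rfl
  · change AddCircle.liftIco (1 : ℝ) 0 p.extend t = _
    rw [AddCircle.liftIco_zero_coe_apply ⟨ht.1, h⟩, p.extend_apply ht]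
  · have : ((1 : ℝ) : UnitAddCircle) = ((0 : ℝ) : UnitAddCircle) := by
      rw [AddCircle.coe_period, AddCircle.coe_zero]
    rw [this]
    change AddCircle.liftIco (1 : ℝ) 0 p.extend _ = _
    rw [AddCircle.liftIco_zero_coe_apply ⟨le_rfl, one_pos⟩]
    simp

theorem curveOfLoop_zero {x : X} (p : Path x x) : curveOfLoop p 0 = x := by
  have := curveOfLoop_coe p (t := 0) ⟨le_rfl, zero_le_one⟩
  rw [AddCircle.coe_zero] at this
  rw [this]
  exact p.source

theorem exists_coe_eq (t : UnitAddCircle) : ∃ r ∈ I, (r : UnitAddCircle) = t := by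
  have hm := (AddCircle.equivIco (1 : ℝ) 0 t).2
  exact ⟨_, ⟨hm.1, by simpa using hm.2.le⟩, AddCircle.coe_equivIco (p := (1 : ℝ)) (a := 0)⟩

theorem loopOfCurve_curveOfLoop {x : X} (p : Path x x) :
    loopOfCurve (curveOfLoop p) (curveOfLoop_zero p) = p := by
  ext t
  exact curveOfLoop_coe p t.2

theorem curveOfLoop_loopOfCurve {x : X} (c : C(UnitAddCircle, X)) (hc : c 0 = x) :
    curveOfLoop (loopOfCurve c hc) = c := by
  ext t
  obtain ⟨r, hr, rfl⟩ := exists_coe_eq t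
  exact curveOfLoop_coe _ hr

/-- A homotopy of loops, transposed, is a loop in the function space `C(I, X)`. Closing up that loop
and evaluating it gives a jointly continuous homotopy on the circle. -/
theorem curveOfLoop_homotopic {x : X} {p q : Path x x} (h : p.Homotopic q) :
    (curveOfLoop p).Homotopic (curveOfLoop q) := by
  obtain ⟨F⟩ := h
  let G : C(I × I, X) := ⟨fun z => F (z.2, z.1), by fun_prop⟩
  let Γ : Path (G.curry 0) (G.curry 0) :=
    { toContinuousMap := G.curry
      source' := rfl
      target' := by ext t; simp [G] }
  let H : C(I × UnitAddCircle, X) := ⟨fun z => curveOfLoop Γ z.2 z.1, by fun_prop⟩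
  have hH (t : I) (r : ℝ) (hr : r ∈ I) : H (t, (r : UnitAddCircle)) = F (t, ⟨r, hr⟩) := by
    change curveOfLoop Γ (r : UnitAddCircle) t = _
    rw [curveOfLoop_coe Γ hr]
    rfl
  refine ⟨⟨H, fun s => ?_, fun s => ?_⟩⟩
  all_goals
    obtain ⟨r, hr, rfl⟩ := exists_coe_eq s
    change H _ = _
    rw [hH _ r hr, curveOfLoop_coe _ hr]
    simp

/-- Turning the circle through half a revolution exchanges the halves on which `p` and `q` are run
through; the homotopy is this rotation. -/
theorem curveOfLoop_trans_homotopic {x y : X} (p : Path x y) (q : Path y x) :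
    (curveOfLoop (p.trans q)).Homotopic (curveOfLoop (q.trans p)) := by
  let c := curveOfLoop (p.trans q)
  let H : C(I × UnitAddCircle, X) :=
    ⟨fun z => c (z.2 + (((z.1 : ℝ) * (1 / 2) : ℝ) : UnitAddCircle)),
      c.continuous.comp (continuous_snd.add ((AddCircle.continuous_mk' (1 : ℝ)).comp
        (by fun_prop)))⟩
  refine ⟨⟨H, fun s => ?_, fun s => ?_⟩⟩
  · change c (s + (((0 : ℝ) * (1 / 2) : ℝ) : UnitAddCircle)) = _
    rw [zero_mul, AddCircle.coe_zero, add_zero]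
  · change c (s + (((1 : ℝ) * (1 / 2) : ℝ) : UnitAddCircle)) = _
    obtain ⟨r, hr, rfl⟩ := exists_coe_eq s
    rw [curveOfLoop_coe _ hr, ← AddCircle.coe_add, one_mul, Path.trans_apply]
    by_cases h : r ≤ 1 / 2
    · have hr' : r + 1 / 2 ∈ I := ⟨by linarith [hr.1], by linarith⟩
      rw [dif_pos h, curveOfLoop_coe _ hr', Path.trans_apply]
      by_cases h0 : r + 1 / 2 ≤ 1 / 2
      · rw [dif_pos h0]
        obtain rfl : r = 0 := le_antisymm (by linarith) hr.1
        simp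
      · rw [dif_neg h0]
        congr 2
        simp only
        ring
    · have hr' : r - 1 / 2 ∈ I := ⟨by linarith, by linarith [hr.2]⟩
      have : ((r + 1 / 2 : ℝ) : UnitAddCircle) = ((r - 1 / 2 : ℝ) : UnitAddCircle) := by
        rw [← AddCircle.coe_add_period (1 : ℝ) (r - 1 / 2)]
        congr 1
        ring
      rw [dif_neg h, this, curveOfLoop_coe _ hr', Path.trans_apply, dif_pos (by
        simp only
        linarith [hr.2])]
      congr 2
      simp only
      ring

theorem curveOfLoop_conj_homotopic {x y : X} (p : Path x x) (r : Path x y) :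
    (curveOfLoop (r.symm.trans (p.trans r))).Homotopic (curveOfLoop p) := by
  refine (curveOfLoop_trans_homotopic _ _).trans (curveOfLoop_homotopic ?_)
  rw [← Path.Homotopic.Quotient.eq]
  simp only [Path.Homotopic.Quotient.mk_trans, Path.Homotopic.Quotient.mk_symm,
    Path.Homotopic.Quotient.trans_assoc, Path.Homotopic.Quotient.trans_symm,
    Path.Homotopic.Quotient.trans_refl]

/-- The standard loop of the circle. -/
def circleLoop : Path (0 : UnitAddCircle) 0 :=
  loopOfCurve (ContinuousMap.id _) rfl

/-- The track `τ` of the point `0` under the homotopy is a loop at `x`, and it conjugates one class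
into the other. -/
theorem isConj_of_homotopic {x : X} {c c' : C(UnitAddCircle, X)} (hc : c 0 = x) (hc' : c' 0 = x)
    (h : c.Homotopic c') :
    IsConj (FundamentalGroup.fromPath (Path.Homotopic.Quotient.mk (loopOfCurve c hc)))
      (FundamentalGroup.fromPath (Path.Homotopic.Quotient.mk (loopOfCurve c' hc'))) := by
  obtain ⟨F⟩ := h
  let τ : Path x x := (F.evalAt 0).cast hc.symm hc'.symm
  have h1 := (Path.Homotopic.map_trans_evalAt F circleLoop).pathCast hc.symm hc'.symm
  have h2 : ((loopOfCurve c hc).trans τ).Homotopic (τ.trans (loopOfCurve c' hc')) := by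
    convert h1 using 1
    · ext t
      simp only [Path.trans_apply, Path.cast_coe]
      rfl
    · ext t
      simp only [Path.trans_apply, Path.cast_coe]
      rfl
  rw [← Path.Homotopic.Quotient.eq, Path.Homotopic.Quotient.mk_trans,
    Path.Homotopic.Quotient.mk_trans] at h2
  rw [isConj_iff]
  refine ⟨FundamentalGroup.fromPath (Path.Homotopic.Quotient.mk τ), ?_⟩
  rw [mul_inv_eq_iff_eq_mul]
  exact h2

theorem homotopic_of_isConj {x : X} {p q : Path x x}
    (h : IsConj (FundamentalGroup.fromPath (Path.Homotopic.Quotient.mk p))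
      (FundamentalGroup.fromPath (Path.Homotopic.Quotient.mk q))) :
    (curveOfLoop p).Homotopic (curveOfLoop q) := by
  obtain ⟨g, hg⟩ := isConj_iff.1 h
  obtain ⟨r, rfl⟩ := Path.Homotopic.Quotient.mk_surjective g
  have h1 : (r.symm.trans (p.trans r)).Homotopic q := by
    rw [← Path.Homotopic.Quotient.eq]
    -- Multiplication in `FundamentalGroup` is concatenation in reverse order, so conjugation by `r`
    -- puts `r.symm` first.
    exact hg
  exact (curveOfLoop_conj_homotopic p r).symm.trans (curveOfLoop_homotopic h1)

namespace FreeHomotopyClass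

/-- The free homotopy class represented by an element of the fundamental group. -/
def ofFundamentalGroup {x : X} (g : FundamentalGroup X x) : FreeHomotopyClass X :=
  mk (curveOfLoop (Quotient.out g))

theorem mk_eq_mk_iff {c c' : C(UnitAddCircle, X)} : mk c = mk c' ↔ c.Homotopic c' :=
  Quotient.eq (r := freeHomotopySetoid X)

theorem isRepresentedBy_mk_curveOfLoop {x : X} (p : Path x x) :
    (mk (curveOfLoop p)).IsRepresentedBy
      (FundamentalGroup.fromPath (Path.Homotopic.Quotient.mk p)) :=
  ⟨curveOfLoop p, curveOfLoop_zero p, rfl, by rw [loopOfCurve_curveOfLoop]⟩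

theorem isRepresentedBy_ofFundamentalGroup {x : X} (g : FundamentalGroup X x) :
    (ofFundamentalGroup g).IsRepresentedBy g := by
  have := isRepresentedBy_mk_curveOfLoop (Quotient.out g)
  have h : FundamentalGroup.fromPath (Path.Homotopic.Quotient.mk (Quotient.out g)) = g :=
    Quotient.out_eq g
  rwa [h] at this

theorem IsRepresentedBy.isConj {x : X} {γ : FreeHomotopyClass X} {g h : FundamentalGroup X x}
    (hg : γ.IsRepresentedBy g) (hh : γ.IsRepresentedBy h) : IsConj g h := by
  obtain ⟨c, hc, rfl, rfl⟩ := hg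
  obtain ⟨c', hc', he, rfl⟩ := hh
  exact isConj_of_homotopic hc hc' (mk_eq_mk_iff.1 he).symm

theorem IsRepresentedBy.eq_of_isConj {x : X} {γ δ : FreeHomotopyClass X}
    {g h : FundamentalGroup X x} (hg : γ.IsRepresentedBy g) (hh : δ.IsRepresentedBy h)
    (hgh : IsConj g h) : γ = δ := by
  obtain ⟨c, hc, rfl, rfl⟩ := hg
  obtain ⟨c', hc', rfl, rfl⟩ := hh
  have := homotopic_of_isConj hgh
  rw [curveOfLoop_loopOfCurve, curveOfLoop_loopOfCurve] at this
  exact mk_eq_mk_iff.2 this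

theorem ofFundamentalGroup_eq_iff {x : X} {g h : FundamentalGroup X x} :
    ofFundamentalGroup g = ofFundamentalGroup h ↔ IsConj g h := by
  refine ⟨fun he => ?_, (isRepresentedBy_ofFundamentalGroup g).eq_of_isConj
    (isRepresentedBy_ofFundamentalGroup h)⟩
  exact (isRepresentedBy_ofFundamentalGroup g).isConj (he ▸ isRepresentedBy_ofFundamentalGroup h)

theorem isRepresentedBy_iff {x : X} {γ : FreeHomotopyClass X} {g : FundamentalGroup X x} :
    γ.IsRepresentedBy g ↔ γ = ofFundamentalGroup g :=
  ⟨fun h => h.eq_of_isConj (isRepresentedBy_ofFundamentalGroup g) (IsConj.refl g),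
    fun h => h ▸ isRepresentedBy_ofFundamentalGroup g⟩

/-- Both loops lift to paths in `ℝ` from `0` to `n + 1`, and such paths are homotopic because `ℝ` is
simply connected. -/
theorem loopOfCurve_circlePow_succ_homotopic (n : ℕ) :
    (loopOfCurve (circlePow (n + 1)) (smul_zero _)).Homotopic
      ((loopOfCurve (circlePow n) (smul_zero n)).trans circleLoop) := by
  let A : Path (0 : ℝ) ((n : ℝ) + 1) :=
    { toFun := fun t => ((n : ℝ) + 1) * (t : ℝ)
      source' := by simp
      target' := by simp }
  let B : Path (0 : ℝ) (n : ℝ) :=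
    { toFun := fun t => (n : ℝ) * (t : ℝ)
      source' := by simp
      target' := by simp }
  let C : Path (n : ℝ) ((n : ℝ) + 1) :=
    { toFun := fun t => (n : ℝ) + (t : ℝ)
      source' := by simp
      target' := by simp }
  have hn : ((n : ℝ) : UnitAddCircle) = 0 := by
    have := AddCircle.coe_nsmul (p := (1 : ℝ)) (n := n) (x := 1)
    rw [AddCircle.coe_period, smul_zero, nsmul_eq_mul, mul_one] at this
    exact this
  have hn1 : (((n : ℝ) + 1 : ℝ) : UnitAddCircle) = 0 := by
    rw [AddCircle.coe_add, hn, AddCircle.coe_period, add_zero]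
  have h : A.Homotopic (B.trans C) := SimplyConnectedSpace.paths_homotopic _ _
  have h1 := (h.map ⟨((↑) : ℝ → UnitAddCircle), AddCircle.continuous_mk' (1 : ℝ)⟩).pathCast
    (AddCircle.coe_zero (p := (1 : ℝ))).symm hn1.symm
  have hmul (k : ℕ) (r : ℝ) : (((k : ℝ) * r : ℝ) : UnitAddCircle) = k • (r : UnitAddCircle) := by
    rw [← AddCircle.coe_nsmul, nsmul_eq_mul]
  convert h1 using 1
  · ext t
    change (n + 1) • ((t : ℝ) : UnitAddCircle) = ((((n : ℝ) + 1) * (t : ℝ) : ℝ) : UnitAddCircle)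
    rw [← hmul]
    push_cast
    rfl
  · ext t
    simp only [Path.cast_coe, Path.map_coe, Function.comp_apply, Path.trans_apply]
    split_ifs with ht
    · exact (hmul n _).symm
    · change ((_ : ℝ) : UnitAddCircle) = (((n : ℝ) + (2 * (t : ℝ) - 1) : ℝ) : UnitAddCircle)
      rw [AddCircle.coe_add, hn, zero_add]

theorem loopOfCurve_comp_circlePow {x : X} (c : C(UnitAddCircle, X)) (hc : c 0 = x) (n : ℕ)
    (hc' : (c.comp (circlePow n)) 0 = x) :
    FundamentalGroup.fromPath (Path.Homotopic.Quotient.mk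
      (loopOfCurve (c.comp (circlePow n)) hc')) =
    (FundamentalGroup.fromPath (Path.Homotopic.Quotient.mk (loopOfCurve c hc))) ^ n := by
  induction n with
  | zero =>
    rw [pow_zero]
    change Path.Homotopic.Quotient.mk _ = Path.Homotopic.Quotient.mk (Path.refl x)
    congr 1
    ext t
    change c (0 • ((t : ℝ) : UnitAddCircle)) = x
    rw [zero_smul, hc]
  | succ n ih =>
    have h0 : (c.comp (circlePow n)) 0 = x := by
      rw [← hc]
      exact congrArg c (smul_zero n)
    rw [pow_succ', ← ih h0]
    change Path.Homotopic.Quotient.mk _ = (Path.Homotopic.Quotient.mk _).trans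
      (Path.Homotopic.Quotient.mk _)
    rw [← Path.Homotopic.Quotient.mk_trans, Path.Homotopic.Quotient.eq]
    have h1 := ((loopOfCurve_circlePow_succ_homotopic n).map c).pathCast hc.symm hc.symm
    convert h1 using 1
    · rfl
    · ext t
      simp only [Path.cast_coe, Path.map_coe, Function.comp_apply, Path.trans_apply]
      split_ifs <;> rfl

theorem isRepresentedBy_pow {x : X} {γ : FreeHomotopyClass X} {g : FundamentalGroup X x}
    (h : γ.IsRepresentedBy g) (n : ℕ) : (γ.pow n).IsRepresentedBy (g ^ n) := by
  obtain ⟨c, hc, rfl, rfl⟩ := h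
  have h0 : (c.comp (circlePow n)) 0 = x := by
    rw [← hc]
    exact congrArg c (smul_zero n)
  exact ⟨c.comp (circlePow n), h0, rfl, loopOfCurve_comp_circlePow c hc n h0⟩

theorem exists_isRepresentedBy_of_joined {x : X} {c : C(UnitAddCircle, X)} (h : Joined x (c 0)) :
    ∃ g : FundamentalGroup X x, (mk c).IsRepresentedBy g := by
  obtain ⟨r⟩ := h
  have h1 := curveOfLoop_conj_homotopic (loopOfCurve c rfl) r.symm
  rw [curveOfLoop_loopOfCurve] at h1
  rw [← mk_eq_mk_iff.2 h1]
  exact ⟨_, isRepresentedBy_mk_curveOfLoop _⟩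

theorem ofFundamentalGroup_isPrimitive_iff {x : X} (g : FundamentalGroup X x) :
    (ofFundamentalGroup g).IsPrimitive ↔
      ¬ ∃ (h : FundamentalGroup X x) (n : ℕ), 2 ≤ n ∧ IsConj g (h ^ n) := by
  refine not_congr ⟨?_, ?_⟩
  · rintro ⟨δ, n, hn, he⟩
    obtain ⟨c, rfl⟩ : ∃ c, mk c = δ := Quotient.exists_rep δ
    have hg := isRepresentedBy_ofFundamentalGroup g
    obtain ⟨d, hd, hdγ, -⟩ := id hg
    obtain ⟨F⟩ : d.Homotopic (c.comp (circlePow n)) := mk_eq_mk_iff.1 (hdγ.trans he)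
    -- The root `mk c` might a priori live away from `x`. The track of `0` under `F` shows that it
    -- lies in the path component of `x`, so it is represented by some group element.
    have hj : Joined x (c 0) := ⟨(F.evalAt 0).cast hd.symm (congrArg c (smul_zero n).symm)⟩
    obtain ⟨h, hh⟩ := exists_isRepresentedBy_of_joined hj
    exact ⟨h, n, hn, hg.isConj (he ▸ isRepresentedBy_pow hh n)⟩
  · rintro ⟨h, n, hn, hgh⟩
    exact ⟨ofFundamentalGroup h, n, hn, (isRepresentedBy_ofFundamentalGroup g).eq_of_isConj
      (isRepresentedBy_pow (isRepresentedBy_ofFundamentalGroup h) n) hgh⟩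

end FreeHomotopyClass

end FreeHomotopy

end

/-! ### A path-connected principal bundle over the punctured torus. -/

noncomputable section

open Topology Set

/-- The point `1/2` of the circle `ℝ / ℤ`. -/
def circleHalf : UnitAddCircle := ((1 / 2 : ℝ) : UnitAddCircle)

/-- The half-open arc `[0, 1/2)` of the circle. -/
def lowerHalf : Set UnitAddCircle := {t | (AddCircle.equivIco (1 : ℝ) 0 t : ℝ) < 1 / 2}

theorem equivIco_coe_of_mem {r : ℝ} (h0 : 0 ≤ r) (h1 : r < 1) :
    (AddCircle.equivIco (1 : ℝ) 0 (r : UnitAddCircle) : ℝ) = r := by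
  rw [AddCircle.equivIco_coe_eq (by constructor <;> simpa using by assumption)]

theorem circleHalf_ne_zero : circleHalf ≠ 0 := by
  intro h
  have h1 := equivIco_coe_of_mem (r := 1 / 2) (by norm_num) (by norm_num)
  have h2 := equivIco_coe_of_mem (r := 0) le_rfl (by norm_num)
  have : ((1 / 2 : ℝ) : UnitAddCircle) = ((0 : ℝ) : UnitAddCircle) := by simpa [circleHalf] using h
  rw [this, h2] at h1
  norm_num at h1

/-- The arc has boundary points `0` and `1/2` only, so membership is locally constant elsewhere.
This is what makes the transition functions continuous on chart overlaps. -/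
theorem eventually_mem_lowerHalf_iff {t : UnitAddCircle} (h0 : t ≠ 0) (h1 : t ≠ circleHalf) :
    ∀ᶠ s in 𝓝 t, (s ∈ lowerHalf ↔ t ∈ lowerHalf) := by
  have hc : ContinuousAt (fun s : UnitAddCircle => (AddCircle.equivIco (1 : ℝ) 0 s : ℝ)) t :=
    continuous_subtype_val.continuousAt.comp
      (AddCircle.continuousAt_equivIco (1 : ℝ) 0 (by simpa using h0))
  have hne : (AddCircle.equivIco (1 : ℝ) 0 t : ℝ) ≠ 1 / 2 := by
    intro h
    apply h1
    rw [circleHalf, ← h]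
    exact (AddCircle.coe_equivIco (p := (1 : ℝ)) (a := 0)).symm
  rcases lt_or_gt_of_ne hne with h | h
  · filter_upwards [hc.eventually_lt_const h] with s hs
    exact ⟨fun _ => h, fun _ => hs⟩
  · filter_upwards [hc.eventually_const_lt h] with s hs
    exact ⟨fun h' => absurd h' (not_lt.2 hs.le), fun h' => absurd h' (not_lt.2 h.le)⟩

theorem isPathConnected_compl_singleton_circle (c : ℝ) :
    IsPathConnected ({(c : UnitAddCircle)}ᶜ : Set UnitAddCircle) := by
  have h : (fun r : ℝ => (r : UnitAddCircle)) '' Ioo c (c + 1) = {(c : UnitAddCircle)}ᶜ := by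
    ext t
    constructor
    · rintro ⟨r, hr, rfl⟩ h
      have h1 := AddCircle.equivIco_coe_eq (p := (1 : ℝ)) (a := c) (Ioo_subset_Ico_self hr)
      have h2 := AddCircle.equivIco_coe_eq (p := (1 : ℝ)) (a := c) (x := c) (by simp)
      have h : (r : UnitAddCircle) = c := h
      rw [h, h2] at h1
      have := congrArg Subtype.val h1
      exact hr.1.ne this
    · intro ht
      have hm := (AddCircle.equivIco (1 : ℝ) c t).2
      have he : ((AddCircle.equivIco (1 : ℝ) c t : ℝ) : UnitAddCircle) = t :=
        AddCircle.coe_equivIco (p := (1 : ℝ)) (a := c)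
      refine ⟨_, ⟨lt_of_le_of_ne hm.1 ?_, hm.2⟩, he⟩
      intro h
      apply ht
      rw [← he, ← h]
      rfl
  rw [← h]
  exact ((convex_Ioo c (c + 1)).isPathConnected (nonempty_Ioo.2 (by linarith))).image
    (AddCircle.continuous_mk' (1 : ℝ))

namespace PuncturedTorus

/-- Three contractible open sets that cover the punctured torus. -/
def chart : Fin 3 → Set PuncturedTorus
  | 0 => {p | p.1.1 ≠ 0 ∧ p.1.2 ≠ 0}
  | 1 => {p | p.1.1 ≠ circleHalf ∧ p.1.2 ≠ 0}
  | 2 => {p | p.1.1 ≠ 0 ∧ p.1.2 ≠ circleHalf}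

/-- A set that meets `chart 0 ∩ chart i` in a union of connected components. -/
def chartHalf : Fin 3 → Set PuncturedTorus
  | 0 => ∅
  | 1 => {p | p.1.1 ∈ lowerHalf}
  | 2 => {p | p.1.2 ∈ lowerHalf}

theorem isOpen_chart (i : Fin 3) : IsOpen (chart i) := by
  have h1 : Continuous fun p : PuncturedTorus => p.1.1 := by fun_prop
  have h2 : Continuous fun p : PuncturedTorus => p.1.2 := by fun_prop
  fin_cases i
  all_goals exact (isOpen_ne_fun h1 continuous_const).inter (isOpen_ne_fun h2 continuous_const)

theorem chart_inter_chart_subset {i j : Fin 3} (h : i ≠ j) : chart i ∩ chart j ⊆ chart 0 := by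
  rintro p ⟨hi, hj⟩
  fin_cases i <;> fin_cases j <;> simp_all [chart]

theorem eventually_mem_chartHalf_iff {i : Fin 3} {p : PuncturedTorus} (h0 : p ∈ chart 0)
    (hi : p ∈ chart i) : ∀ᶠ q in 𝓝 p, (q ∈ chartHalf i ↔ p ∈ chartHalf i) := by
  have h1 : Continuous fun p : PuncturedTorus => p.1.1 := by fun_prop
  have h2 : Continuous fun p : PuncturedTorus => p.1.2 := by fun_prop
  fin_cases i
  · simp [chartHalf]
  · exact (h1.tendsto p).eventually (eventually_mem_lowerHalf_iff h0.1 hi.1)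
  · exact (h2.tendsto p).eventually (eventually_mem_lowerHalf_iff h0.2 hi.2)

/-- Each chart is a product of two circles with one point removed from each; the puncture is
excluded automatically since one of the removed coordinates is `0`. -/
theorem isPathConnected_chart (i : Fin 3) : IsPathConnected (chart i) := by
  have key (c d : UnitAddCircle) (h : c = 0 ∨ d = 0) :
      IsPathConnected {p : PuncturedTorus | p.1.1 ≠ c ∧ p.1.2 ≠ d} := by
    have hind : IsInducing (Subtype.val : PuncturedTorus → UnitAddCircle × UnitAddCircle) := ⟨rfl⟩
    rw [hind.isPathConnected_iff]
    have : Subtype.val '' {p : PuncturedTorus | p.1.1 ≠ c ∧ p.1.2 ≠ d} = {c}ᶜ ×ˢ {d}ᶜ := by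
      ext ⟨s, t⟩
      simp only [mem_image, mem_ofPred_eq, Subtype.exists, mem_prod, mem_compl_iff,
        mem_singleton_iff]
      constructor
      · rintro ⟨q, hq, h, rfl⟩
        exact h
      · rintro hst
        refine ⟨(s, t), ?_, hst, rfl⟩
        rintro h0
        have := Prod.ext_iff.1 h0
        rcases h with rfl | rfl
        · exact hst.1 this.1
        · exact hst.2 this.2
    rw [this]
    obtain ⟨c, rfl⟩ := QuotientAddGroup.mk_surjective c
    obtain ⟨d, rfl⟩ := QuotientAddGroup.mk_surjective d
    exact (isPathConnected_compl_singleton_circle c).prod (isPathConnected_compl_singleton_circle d)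
  fin_cases i
  · exact key _ _ (Or.inl rfl)
  · exact key _ _ (Or.inr rfl)
  · exact key _ _ (Or.inl rfl)

variable {G : Type*} [Group G]

/-- The transition function from `chart 0` to `chart i` of the principal bundle with monodromy
`g 1`, `g 2` along the two cuts of the punctured torus. -/
def transition (g : Fin 3 → G) (i : Fin 3) (p : PuncturedTorus) : G :=
  open Classical in if p ∈ chartHalf i then g i else 1

theorem continuousAt_transition [TopologicalSpace G] (g : Fin 3 → G) {i : Fin 3} {p : PuncturedTorus}
    (h0 : p ∈ chart 0) (hi : p ∈ chart i) : ContinuousAt (transition g i) p := by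
  refine (continuousAt_const (y := transition g i p)).congr ?_
  filter_upwards [eventually_mem_chartHalf_iff h0 hi] with q hq
  unfold transition
  split_ifs <;> tauto

variable [TopologicalSpace G] [DiscreteTopology G]

/-- The principal bundle with discrete structure group `G` and monodromy `g 1`, `g 2` along the two
cuts of the punctured torus. -/
def bundleCore (g : Fin 3 → G) : FiberBundleCore (Fin 3) PuncturedTorus G where
  baseSet := chart
  isOpen_baseSet := isOpen_chart
  indexAt p := open Classical in if p ∈ chart 0 then 0 else if p ∈ chart 1 then 1 else 2
  mem_baseSet_at p := by
    split_ifs with h0 h1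
    · exact h0
    · exact h1
    · obtain ⟨⟨s, t⟩, hp⟩ := p
      have := circleHalf_ne_zero
      have := circleHalf_ne_zero.symm
      simp only [chart, mem_ofPred_eq] at h0 h1 ⊢
      simp only [ne_eq, Prod.ext_iff] at hp
      by_cases hs : s = 0 <;> by_cases ht : t = 0 <;> simp_all
  -- Right multiplication commutes with left translation by `G`, which therefore acts on the total
  -- space. The coboundary form makes the cocycle identity automatic; the bundle can still be
  -- nontrivial because `transition g i` need not be continuous on all of `chart i`.
  coordChange i j p v := v * (transition g i p)⁻¹ * transition g j p
  coordChange_self := by simp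
  continuousOn_coordChange i j := by
    rintro ⟨p, v⟩ ⟨⟨hi, hj⟩, -⟩
    apply ContinuousAt.continuousWithinAt
    by_cases hij : i = j
    · subst hij
      simpa using continuousAt_snd
    · have h0 := chart_inter_chart_subset hij ⟨hi, hj⟩
      have ti : ContinuousAt (fun q : PuncturedTorus × G => transition g i q.1) (p, v) :=
        ContinuousAt.comp (f := Prod.fst) (x := (p, v)) (continuousAt_transition g h0 hi)
          continuousAt_fst
      have tj : ContinuousAt (fun q : PuncturedTorus × G => transition g j q.1) (p, v) :=
        ContinuousAt.comp (f := Prod.fst) (x := (p, v)) (continuousAt_transition g h0 hj)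
          continuousAt_fst
      exact (continuousAt_snd.mul ti.inv).mul tj
  coordChange_comp := by
    intro i j k p _ v
    simp [mul_assoc]

variable (g : Fin 3 → G)

/-- The point of the bundle over `p` with coordinate `v` in the preferred chart at `p`. -/
def point (p : PuncturedTorus) (v : G) : (bundleCore g).TotalSpace := ⟨p, v⟩

/-- The coordinate of a point of the bundle in the preferred chart. -/
def coord (e : (bundleCore g).TotalSpace) : G := e.2

instance : MulAction G (bundleCore g).TotalSpace where
  smul h e := point g e.1 (h * coord g e)
  one_smul e := by
    change point g e.1 (1 * coord g e) = e
    rw [one_mul]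
    rfl
  mul_smul h k e := by
    change point g e.1 (h * k * coord g e) = point g e.1 (h * (k * coord g e))
    rw [mul_assoc]

theorem localTriv_apply_snd (i : Fin 3) (e : (bundleCore g).TotalSpace) :
    ((bundleCore g).localTriv i e).2 =
      coord g e * (transition g ((bundleCore g).indexAt e.1) e.1)⁻¹ * transition g i e.1 := rfl

theorem localTriv_smul (i : Fin 3) (h : G) (e : (bundleCore g).TotalSpace) :
    ((bundleCore g).localTriv i (h • e)).2 = h * ((bundleCore g).localTriv i e).2 := by
  rw [localTriv_apply_snd, localTriv_apply_snd, mul_assoc, mul_assoc, ← mul_assoc h]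
  rfl

/-- In every chart the action is left translation in the fibre `G`: continuous, free, and transitive
on fibres. -/
theorem isQuotientCoveringMap_proj :
    IsQuotientCoveringMap (bundleCore g).proj G := by
  rw [isQuotientCoveringMap_iff_isCoveringMap_and]
  refine ⟨FiberBundle.isCoveringMap (F := G) (E := (bundleCore g).Fiber),
    fun p => ⟨point g p 1, rfl⟩, ⟨fun h => ?_⟩,
    ⟨fun h k e hk => ?_⟩, fun {e e'} => ⟨fun he => ?_, ?_⟩⟩
  · rw [continuous_iff_continuousAt]
    intro e
    rw [FiberBundle.continuousAt_totalSpace G]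
    refine ⟨(bundleCore g).continuous_proj.continuousAt, ?_⟩
    have h1 := ((FiberBundle.continuousAt_totalSpace G (fun e : (bundleCore g).TotalSpace => e)
      (x₀ := e)).1 continuousAt_id).2
    have h2 := (continuousAt_const (y := h)).mul h1
    refine h2.congr (Filter.Eventually.of_forall fun e' => ?_)
    exact (localTriv_smul g _ h e').symm
  · have h1 : coord g (h • e) = coord g (k • e) := by
      have hk' : h • e = k • e := hk
      rw [hk']
    exact mul_right_cancel h1
  · obtain ⟨p, v⟩ := e
    obtain ⟨p', v'⟩ := e'
    obtain rfl : p = p' := he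
    refine ⟨coord g ⟨p, v⟩ * (coord g ⟨p, v'⟩)⁻¹, ?_⟩
    change point g p (coord g ⟨p, v⟩ * (coord g ⟨p, v'⟩)⁻¹ * coord g ⟨p, v'⟩) = _
    rw [inv_mul_cancel_right]
    rfl
  · rintro ⟨h, rfl⟩
    rfl

/-- The sheet of the bundle over `chart i` that has constant coordinate `v`. -/
def sheet (i : Fin 3) (v : G) : Set (bundleCore g).TotalSpace :=
  (fun p => ((bundleCore g).localTriv i).toOpenPartialHomeomorph.symm (p, v)) '' chart i

theorem mem_sheet_iff {i : Fin 3} {v : G} {e : (bundleCore g).TotalSpace} :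
    e ∈ sheet g i v ↔ e.1 ∈ chart i ∧ ((bundleCore g).localTriv i e).2 = v := by
  set t := (bundleCore g).localTriv i
  constructor
  · rintro ⟨p, hp, rfl⟩
    have hp' : p ∈ t.baseSet := hp
    have h2 := t.apply_symm_apply' hp' (x := v)
    refine ⟨?_, ?_⟩
    · have := t.proj_symm_apply' hp' (x := v)
      exact (show chart i _ from this ▸ hp)
    · rw [h2]
  · rintro ⟨h1, rfl⟩
    refine ⟨e.1, h1, ?_⟩
    have : e ∈ t.source := t.mem_source.2 h1
    have h3 := t.symm_apply_mk_proj this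
    exact h3

theorem isPathConnected_sheet (i : Fin 3) (v : G) : IsPathConnected (sheet g i v) := by
  refine (isPathConnected_chart i).image' ?_
  refine ((bundleCore g).localTriv i).toOpenPartialHomeomorph.continuousOn_symm.comp
    (by fun_prop) ?_
  intro p hp
  exact ((bundleCore g).localTriv i).mem_target.2 hp

theorem exists_mem_chart_mem_chartHalf :
    ∃ p, (∀ i, p ∈ chart i) ∧ p ∈ chartHalf 1 ∧ p ∈ chartHalf 2 := by
  have h := equivIco_coe_of_mem (r := 1 / 4) (by norm_num) (by norm_num)
  have h0 : ((1 / 4 : ℝ) : UnitAddCircle) ≠ 0 := by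
    intro h'
    have h1 := equivIco_coe_of_mem (r := 0) le_rfl (by norm_num)
    rw [h', ← AddCircle.coe_zero (p := (1 : ℝ)), h1] at h
    norm_num at h
  have h1 : ((1 / 4 : ℝ) : UnitAddCircle) ≠ circleHalf := by
    intro h'
    have h1 := equivIco_coe_of_mem (r := 1 / 2) (by norm_num) (by norm_num)
    rw [h', circleHalf, h1] at h
    norm_num at h
  have h2 : ((1 / 4 : ℝ) : UnitAddCircle) ∈ lowerHalf := by
    change (AddCircle.equivIco (1 : ℝ) 0 _ : ℝ) < 1 / 2
    rw [h]
    norm_num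
  -- At `(1/4, 1/4)` the transition to `chart i` is `g i` for `i = 1, 2`; its counterpart `(3/4,
  -- 3/4)` below lies in the other component of each overlap, where the transition is `1`.
  refine ⟨⟨(((1 / 4 : ℝ) : UnitAddCircle), ((1 / 4 : ℝ) : UnitAddCircle)),
    fun h => h0 (Prod.ext_iff.1 h).1⟩, fun i => ?_, h2, h2⟩
  fin_cases i
  exacts [⟨h0, h0⟩, ⟨h1, h0⟩, ⟨h0, h1⟩]

theorem exists_mem_chart_notMem_chartHalf :
    ∃ p, (∀ i, p ∈ chart i) ∧ ∀ i, p ∉ chartHalf i := by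
  have h := equivIco_coe_of_mem (r := 3 / 4) (by norm_num) (by norm_num)
  have h0 : ((3 / 4 : ℝ) : UnitAddCircle) ≠ 0 := by
    intro h'
    have h1 := equivIco_coe_of_mem (r := 0) le_rfl (by norm_num)
    rw [h', ← AddCircle.coe_zero (p := (1 : ℝ)), h1] at h
    norm_num at h
  have h1 : ((3 / 4 : ℝ) : UnitAddCircle) ≠ circleHalf := by
    intro h'
    have h1 := equivIco_coe_of_mem (r := 1 / 2) (by norm_num) (by norm_num)
    rw [h', circleHalf, h1] at h
    norm_num at h
  have h2 : ((3 / 4 : ℝ) : UnitAddCircle) ∉ lowerHalf := by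
    change ¬ (AddCircle.equivIco (1 : ℝ) 0 _ : ℝ) < 1 / 2
    rw [h]
    norm_num
  refine ⟨⟨(((3 / 4 : ℝ) : UnitAddCircle), ((3 / 4 : ℝ) : UnitAddCircle)),
    fun h => h0 (Prod.ext_iff.1 h).1⟩, fun i => ?_, fun i => ?_⟩
  · fin_cases i
    exacts [⟨h0, h0⟩, ⟨h1, h0⟩, ⟨h0, h1⟩]
  · fin_cases i
    exacts [id, h2, h2]

theorem mem_sheet_of_mem_sheet_zero {i : Fin 3} {v : G} {e : (bundleCore g).TotalSpace}
    (he : e ∈ sheet g 0 v) (hi : e.1 ∈ chart i) : e ∈ sheet g i (v * transition g i e.1) := by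
  rw [mem_sheet_iff] at he ⊢
  refine ⟨hi, ?_⟩
  obtain ⟨-, rfl⟩ := he
  rw [localTriv_apply_snd, localTriv_apply_snd]
  simp [transition, chartHalf]

theorem exists_mem_sheet {i : Fin 3} {p : PuncturedTorus} (hp : p ∈ chart i) (v : G) :
    ∃ e ∈ sheet g i v, e.1 = p := by
  refine ⟨_, mem_image_of_mem _ hp, ?_⟩
  exact ((bundleCore g).localTriv i).proj_symm_apply' hp

/-- The sheet of `chart i` with coordinate `g i` meets the sheet of `chart 0` with coordinate `1`
over `p`, and the one with coordinate `g i` over `q`. Crossing it joins `e` to `g i • e`. The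
elements `v` for which `e` is joined to `v • e` form a subgroup, which is everything by `hg`. -/
theorem pathConnectedSpace_totalSpace (hg : Subgroup.closure {g 1, g 2} = ⊤) :
    PathConnectedSpace (bundleCore g).TotalSpace := by
  have hcov := isQuotientCoveringMap_proj g
  have hcont := hcov.toContinuousConstSMul
  have sheet_joined {i : Fin 3} {v : G} {e e' : (bundleCore g).TotalSpace} (h : e ∈ sheet g i v)
      (h' : e' ∈ sheet g i v) : Joined e e' :=
    ((isPathConnected_sheet g i v).joinedIn e h e' h').joined
  obtain ⟨p, hp, hp1, hp2⟩ := exists_mem_chart_mem_chartHalf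
  obtain ⟨q, hq, hq'⟩ := exists_mem_chart_notMem_chartHalf
  obtain ⟨e, he, hep⟩ := exists_mem_sheet g (hp 0) (1 : G)
  have smul_mem (v : G) : v • e ∈ sheet g 0 v := by
    rw [mem_sheet_iff] at he ⊢
    exact ⟨he.1, by rw [localTriv_smul, he.2, mul_one]⟩
  have bridge (i : Fin 3) (v : G) :
      ∃ r, r ∈ sheet g 0 v ∧ r ∈ sheet g i v := by
    obtain ⟨r, hr, hrq⟩ := exists_mem_sheet g (hq 0) v
    refine ⟨r, hr, ?_⟩
    have := mem_sheet_of_mem_sheet_zero g (i := i) hr (hrq ▸ hq i)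
    rwa [hrq, transition, if_neg (hq' i), mul_one] at this
  have gen (i : Fin 3) (hi : p ∈ chartHalf i) : Joined e (g i • e) := by
    obtain ⟨r, hr0, hri⟩ := bridge i (g i)
    have := mem_sheet_of_mem_sheet_zero g (i := i) he (hep ▸ hp i)
    rw [hep, transition, if_pos hi, one_mul] at this
    exact (sheet_joined this hri).trans (sheet_joined hr0 (smul_mem (g i)))
  have joined_smul {e₁ e₂ : (bundleCore g).TotalSpace} (v : G) (h : Joined e₁ e₂) :
      Joined (v • e₁) (v • e₂) :=
    h.map (continuous_const_smul v)
  let H : Subgroup G :=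
    { carrier := {v | Joined e (v • e)}
      one_mem' := by
        change Joined e ((1 : G) • e)
        rw [one_smul]
      mul_mem' := by
        intro v w hv hw
        change Joined e ((v * w) • e)
        rw [mul_smul]
        exact Joined.trans hv (joined_smul v hw)
      inv_mem' := by
        intro v hv
        have := joined_smul v⁻¹ hv
        rw [inv_smul_smul] at this
        exact this.symm }
  have hH : H = ⊤ := by
    rw [← top_le_iff, ← hg, Subgroup.closure_le]
    rintro v (rfl | rfl)
    exacts [gen 1 hp1, gen 2 hp2]
  have all (e' : (bundleCore g).TotalSpace) : Joined e e' := by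
    obtain ⟨i, hi⟩ : ∃ i, e'.1 ∈ chart i := ⟨_, (bundleCore g).mem_baseSet_at e'.1⟩
    have h1 : e' ∈ sheet g i ((bundleCore g).localTriv i e').2 := (mem_sheet_iff g).2 ⟨hi, rfl⟩
    obtain ⟨r, hr0, hri⟩ := bridge i ((bundleCore g).localTriv i e').2
    have h2 : ((bundleCore g).localTriv i e').2 ∈ H := hH ▸ Subgroup.mem_top _
    exact Joined.trans h2 ((sheet_joined (smul_mem _) hr0).trans (sheet_joined hri h1))
  exact ⟨⟨e⟩, fun e₁ e₂ => (all e₁).symm.trans (all e₂)⟩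

theorem exists_surjective_fundamentalGroup_freeGroup (x : PuncturedTorus) :
    ∃ f : FundamentalGroup PuncturedTorus x →* FreeGroup (Fin 2), Function.Surjective f := by
  let _ : TopologicalSpace (FreeGroup (Fin 2)) := ⊥
  have : DiscreteTopology (FreeGroup (Fin 2)) := ⟨rfl⟩
  let g : Fin 3 → FreeGroup (Fin 2) := ![1, FreeGroup.of 0, FreeGroup.of 1]
  have hg : Subgroup.closure {g 1, g 2} = ⊤ := by
    rw [← FreeGroup.closure_range_of]
    congr 1
    ext v
    simp [g, Fin.exists_fin_two, eq_comm]
  have := pathConnectedSpace_totalSpace g hg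
  have hcov := isQuotientCoveringMap_proj g
  obtain ⟨e, he⟩ := hcov.surjective x
  -- Path-connectedness of the total space is what makes the monodromy surjective. It takes values
  -- in the opposite group, which inversion identifies with the group itself.
  have hs := hcov.fundamentalGroupToMulOpposite_surjective (x := x) ⟨e, he⟩
  exact ⟨(MulEquiv.inv' (FreeGroup (Fin 2))).symm.toMonoidHom.comp
    (hcov.fundamentalGroupToMulOpposite (x := x) ⟨e, he⟩),
    (MulEquiv.inv' (FreeGroup (Fin 2))).symm.surjective.comp hs⟩

end PuncturedTorus

end

/-! ### Conjugacy of cyclically reduced words. -/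

namespace FreeGroup

variable {α : Type*}

theorem isCyclicallyReduced_cons_iff {x : α × Bool} {u : List (α × Bool)} :
    IsCyclicallyReduced (x :: u) ↔ IsReduced (x :: (u ++ [x])) := by
  rw [← List.cons_append, IsReduced, List.isChain_append, isCyclicallyReduced_iff]
  simp [IsReduced]

theorem isCyclicallyReduced_concat_iff {x : α × Bool} {u : List (α × Bool)} :
    IsCyclicallyReduced (u ++ [x]) ↔ IsReduced (x :: (u ++ [x])) := by
  rw [show x :: (u ++ [x]) = [x] ++ (u ++ [x]) from rfl, IsReduced, List.isChain_append (l₁ := [x]),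
    isCyclicallyReduced_iff]
  simp [IsReduced]

theorem isCyclicallyReduced_cons_iff_concat {x : α × Bool} {u : List (α × Bool)} :
    IsCyclicallyReduced (x :: u) ↔ IsCyclicallyReduced (u ++ [x]) :=
  isCyclicallyReduced_cons_iff.trans isCyclicallyReduced_concat_iff.symm

theorem IsReduced.eq_of_mk_eq {u v : List (α × Bool)} (hu : IsReduced u) (hv : IsReduced v)
    (h : mk u = mk v) : u = v := by
  classical
  rw [← hu.reduce_eq, ← hv.reduce_eq]
  exact reduce.sound h

theorem IsReduced.invRev {u : List (α × Bool)} (hu : IsReduced u) : IsReduced (invRev u) := by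
  classical
  exact IsReduced.of_reduce_eq (by rw [reduce_invRev, hu.reduce_eq])

theorem mk_append (u v : List (α × Bool)) : mk (u ++ v) = mk u * mk v := mul_mk.symm

theorem mk_inv_singleton (x : α × Bool) : (mk [x])⁻¹ = mk [(x.1, !x.2)] := by
  simp [inv_mk, FreeGroup.invRev]

/-- Induction on the conjugator `x :: L`. If `u` starts with `x` or ends with its inverse,
conjugating by `x` only rotates `u`, and `L` remains. If `u` is nonempty and neither happens, the
conjugate is reduced as written, hence equal to `v`; but its first letter is inverse to its last, so
`v` is not cyclically reduced. -/
theorem IsCyclicallyReduced.isRotated_of_mk_eq_conj {L : List (α × Bool)} (hL : IsReduced L) :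
    ∀ {u v : List (α × Bool)}, IsCyclicallyReduced u → IsCyclicallyReduced v →
      mk v = (mk L)⁻¹ * mk u * mk L → u ~r v := by
  induction L with
  | nil =>
    intro u v hu hv h
    rw [← one_eq_mk, inv_one, one_mul, mul_one] at h
    rw [hv.isReduced.eq_of_mk_eq hu.isReduced h]
  | cons x L ih =>
    intro u v hu hv h
    have hL' : IsReduced L := hL.infix ⟨[x], [], by simp⟩
    have hxL : mk (x :: L) = mk [x] * mk L := mk_append [x] L
    by_cases h1 : ∃ u', u = x :: u'
    · obtain ⟨u, rfl⟩ := h1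
      have hr : x :: u ~r u ++ [x] := by simpa using List.isRotated_append (l := [x]) (l' := u)
      refine hr.trans (ih hL' (isCyclicallyReduced_cons_iff_concat.1 hu) hv ?_)
      rw [h, hxL, mk_append u, show mk (x :: u) = mk [x] * mk u from mk_append [x] u]
      group
    by_cases h2 : ∃ u', u = u' ++ [(x.1, !x.2)]
    · obtain ⟨u, rfl⟩ := h2
      have hr : u ++ [(x.1, !x.2)] ~r (x.1, !x.2) :: u := List.isRotated_append
      refine hr.trans (ih hL' (isCyclicallyReduced_cons_iff_concat.2 hu) hv ?_)
      rw [h, hxL, mk_append u, show mk ((x.1, !x.2) :: u) = mk [(x.1, !x.2)] * mk u from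
        mk_append [_] u, ← mk_inv_singleton]
      group
    by_cases h3 : u = []
    · subst h3
      rw [← one_eq_mk, mul_one, inv_mul_cancel] at h
      rw [hv.isReduced.eq_of_mk_eq IsReduced.nil h]
    exfalso
    have hred : IsReduced (invRev (x :: L) ++ (u ++ (x :: L))) := by
      refine List.isChain_append.2 ⟨hL.invRev, List.isChain_append.2 ⟨hu.isReduced, hL, ?_⟩, ?_⟩
      · intro a ha b hb hab
        obtain rfl : x = b := by simpa using hb
        by_contra hne
        obtain ⟨u', rfl⟩ := List.getLast?_eq_some_iff.1 ha
        refine h2 ⟨u', ?_⟩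
        congr
        exact Prod.ext hab (Bool.eq_not.2 hne)
      · intro a ha b hb hab
        obtain ⟨u', rfl⟩ : ∃ u', u = b :: u' := by
          rcases u with _ | ⟨c, u⟩
          · exact absurd rfl h3
          · exact ⟨u, by simpa using hb⟩
        obtain rfl : (x.1, !x.2) = a := by simpa [FreeGroup.invRev] using ha
        by_contra hne
        exact h1 ⟨u', by congr; exact Prod.ext hab.symm (by simpa [eq_comm] using hne)⟩
    have hv' : v = invRev (x :: L) ++ (u ++ (x :: L)) := by
      refine hv.isReduced.eq_of_mk_eq hred ?_
      rw [h, mk_append, mk_append, inv_mk, mul_assoc]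
    obtain ⟨M, y, hy⟩ := List.eq_nil_or_concat (x :: L) |>.resolve_left (by simp)
    rw [List.concat_eq_append] at hy
    rw [hy] at hv'
    have hv'' : v = (y.1, !y.2) :: (invRev M ++ (u ++ M)) ++ [y] := by
      rw [hv']
      simp [FreeGroup.invRev]
    rw [hv'', isCyclicallyReduced_cons_append_iff] at hv
    simpa using hv.2 rfl

theorem mk_isConj_of_isRotated {u v : List (α × Bool)} (h : u ~r v) : IsConj (mk u) (mk v) := by
  obtain ⟨n, hn, rfl⟩ := List.isRotated_iff_mod.1 h
  rw [List.rotate_eq_drop_append_take hn]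
  conv_lhs => rw [← List.take_append_drop n u]
  rw [mk_append, mk_append, isConj_iff]
  exact ⟨(mk (List.take n u))⁻¹, by group⟩

theorem IsCyclicallyReduced.isConj_mk_iff {u v : List (α × Bool)} (hu : IsCyclicallyReduced u)
    (hv : IsCyclicallyReduced v) : IsConj (mk u) (mk v) ↔ u ~r v := by
  classical
  refine ⟨fun h => ?_, mk_isConj_of_isRotated⟩
  obtain ⟨c, hc⟩ := isConj_iff.1 h
  refine isRotated_of_mk_eq_conj (isReduced_toWord (x := c⁻¹)) hu hv ?_
  rw [mk_toWord, inv_inv, hc]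

theorem exists_isCyclicallyReduced_isConj (g : FreeGroup α) :
    ∃ u, IsCyclicallyReduced u ∧ IsConj g (mk u) := by
  classical
  refine ⟨reduceCyclically g.toWord, reduceCyclically.isCyclicallyReduced isReduced_toWord, ?_⟩
  refine IsConj.symm (isConj_iff.2 ⟨mk (reduceCyclically.conjugator g.toWord), ?_⟩)
  conv_rhs => rw [← mk_toWord (x := g), ← reduceCyclically.conj_conjugator_reduceCyclically g.toWord]
  rw [mk_append, mk_append, inv_mk]

end FreeGroup

/-! ### Residual finiteness and the Hopf property of free groups. -/

namespace FreeGroup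

variable {α : Type*}

/-- The relation between positions in the word `L` that the generator `i` has to induce in order
that `L`, read as a permutation, moves the last position to the first one. -/
def wordStep (L : List (α × Bool)) (i : α) (s t : Fin (L.length + 1)) : Prop :=
  (∃ h : t.1 < L.length, s.1 = t.1 + 1 ∧ L[t.1] = (i, true)) ∨
    (∃ h : s.1 < L.length, t.1 = s.1 + 1 ∧ L[s.1] = (i, false))

theorem IsReduced.getElem {L : List (α × Bool)} (hL : IsReduced L) {n : ℕ}
    (hn : n + 1 < L.length) (h : L[n].1 = L[n + 1].1) : L[n].2 = L[n + 1].2 :=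
  List.isChain_iff_getElem.1 hL n hn h

/-- Two different steps with the same label out of one position would come from adjacent letters
that are inverse to each other. -/
theorem IsReduced.wordStep_right_unique {L : List (α × Bool)} (hL : IsReduced L) {i : α}
    {s t t' : Fin (L.length + 1)} (h : wordStep L i s t) (h' : wordStep L i s t') : t = t' := by
  obtain ⟨s, hs⟩ := s
  obtain ⟨t, ht⟩ := t
  obtain ⟨t', ht'⟩ := t'
  rw [Fin.mk.injEq]
  rcases h with ⟨h1, h2, h3⟩ | ⟨h1, h2, h3⟩ <;> rcases h' with ⟨h1', h2', h3'⟩ | ⟨h1', h2', h3'⟩ <;>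
    simp only at *
  · omega
  · subst h2
    have := hL.getElem h1' (by rw [h3, h3'])
    simp [h3, h3'] at this
  · subst h2'
    have := hL.getElem h1 (by rw [h3, h3'])
    simp [h3, h3'] at this
  · omega

theorem IsReduced.wordStep_left_unique {L : List (α × Bool)} (hL : IsReduced L) {i : α}
    {s s' t : Fin (L.length + 1)} (h : wordStep L i s t) (h' : wordStep L i s' t) : s = s' := by
  obtain ⟨s, hs⟩ := s
  obtain ⟨s', hs'⟩ := s'
  obtain ⟨t, ht⟩ := t
  rw [Fin.mk.injEq]
  rcases h with ⟨h1, h2, h3⟩ | ⟨h1, h2, h3⟩ <;> rcases h' with ⟨h1', h2', h3'⟩ | ⟨h1', h2', h3'⟩ <;>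
    simp only at *
  · omega
  · subst h2'
    have := hL.getElem h1 (by rw [h3, h3'])
    simp [h3, h3'] at this
  · subst h2
    have := hL.getElem h1' (by rw [h3, h3'])
    simp [h3, h3'] at this
  · omega

/-- The steps labelled `i` form a partial injection of a finite set into itself, and such a map
extends to a permutation. -/
theorem IsReduced.exists_perm {L : List (α × Bool)} (hL : IsReduced L) (i : α) :
    ∃ σ : Equiv.Perm (Fin (L.length + 1)), ∀ s t, wordStep L i s t → σ s = t := by
  classical
  let S : Set (Fin (L.length + 1)) := {s | ∃ t, wordStep L i s t}
  let f : Fin (L.length + 1) → Fin (L.length + 1) := fun s =>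
    if h : ∃ t, wordStep L i s t then h.choose else 0
  have hf {s t} (h : wordStep L i s t) : f s = t := by
    have h' : ∃ t, wordStep L i s t := ⟨t, h⟩
    simp only [f, dif_pos h']
    exact hL.wordStep_right_unique h'.choose_spec h
  have hinj : Set.InjOn f S := by
    rintro s ⟨t, h⟩ s' ⟨t', h'⟩ he
    rw [hf h, hf h'] at he
    subst he
    exact hL.wordStep_left_unique h h'
  obtain ⟨g, hg⟩ := Set.MapsTo.exists_equiv_extend_of_card_eq (t := Finset.univ)
    (by simp) (s := S) (f := f) (by intro; simp) hinj
  refine ⟨g.trans (Equiv.subtypeUnivEquiv (by simp)), fun s t h => ?_⟩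
  rw [← hf h]
  exact hg s ⟨t, h⟩

/-- Residual finiteness: let the generators permute the positions `0, …, L.length` of the reduced
word `L` of `w` so that each suffix carries the last position to the place where the suffix begins.
The whole word then carries the last position to `0`, so it acts nontrivially unless it is empty. -/
theorem exists_hom_perm_ne_one {w : FreeGroup α} (hw : w ≠ 1) :
    ∃ (n : ℕ) (f : FreeGroup α →* Equiv.Perm (Fin n)), f w ≠ 1 := by
  classical
  obtain ⟨L, hL, rfl⟩ : ∃ L, IsReduced L ∧ mk L = w := ⟨w.toWord, isReduced_toWord, mk_toWord⟩
  choose σ hσ using hL.exists_perm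
  refine ⟨L.length + 1, lift σ, fun h1 => hw ?_⟩
  have key : ∀ n (hn : n ≤ L.length),
      lift σ (mk (L.drop n)) (Fin.last _) = ⟨n, by omega⟩ := by
    intro n hn
    induction hn using Nat.decreasingInduction with
    | self => simp [← one_eq_mk, Fin.last]
    | of_succ k hk ih =>
      rw [List.drop_eq_getElem_cons hk, ← List.singleton_append, mk_append, _root_.map_mul,
        Equiv.Perm.mul_apply, ih]
      obtain ⟨i, b, hi⟩ : ∃ i b, L[k] = (i, b) := ⟨_, _, rfl⟩
      rw [hi]
      cases b
      · have : σ i ⟨k, by omega⟩ = ⟨k + 1, by omega⟩ := hσ i _ _ (Or.inr ⟨hk, rfl, hi⟩)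
        simp [← this]
      · have : σ i ⟨k + 1, by omega⟩ = ⟨k, by omega⟩ := hσ i _ _ (Or.inl ⟨hk, rfl, hi⟩)
        simp [← this]
  have h0 := key 0 (Nat.zero_le _)
  rw [List.drop_zero, h1] at h0
  have : L.length = 0 := by simpa [Fin.ext_iff] using h0
  rw [List.length_eq_zero_iff.1 this, one_eq_mk]

/-- Finitely generated free groups are Hopfian. -/
theorem injective_of_surjective [Finite α] {f : FreeGroup α →* FreeGroup α}
    (hf : Function.Surjective f) : Function.Injective f := by
  rw [injective_iff_map_eq_one]
  intro w hw
  by_contra hne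
  obtain ⟨n, φ, hφ⟩ := exists_hom_perm_ne_one hne
  have : Finite (FreeGroup α →* Equiv.Perm (Fin n)) := Finite.of_equiv _ (lift (α := α))
  -- Malcev's argument: precomposition with a surjection is an injective self-map of a finite set of
  -- homomorphisms, hence surjective. So `φ` factors through `f` and kills `w`.
  have hinj : Function.Injective fun ψ : FreeGroup α →* Equiv.Perm (Fin n) => ψ.comp f :=
    fun ψ ψ' h => (MonoidHom.cancel_right hf).1 h
  obtain ⟨ψ, rfl⟩ := Finite.surjective_of_injective hinj φ
  exact hφ (by simp [hw])

theorem lift_bijective_of_closure_eq_top {G : Type*} [Group G] {a b : G}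
    (hab : Subgroup.closure {a, b} = ⊤) {f : G →* FreeGroup (Fin 2)}
    (hf : Function.Surjective f) : Function.Bijective (lift ![a, b]) := by
  have hs : Function.Surjective (lift ![a, b]) := by
    rw [← MonoidHom.range_eq_top, range_lift_eq_closure, ← hab]
    congr 1
    ext v
    simp [eq_comm, or_comm]
  refine ⟨?_, hs⟩
  have := injective_of_surjective (f := f.comp (lift ![a, b])) (by
    rw [MonoidHom.coe_comp]
    exact hf.comp hs)
  rw [MonoidHom.coe_comp] at this
  exact this.of_comp

end FreeGroup

/-! ### Orbits of periodic points. -/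

section Orbits

open Function

variable {S Q : Type*} {T : S → S} {L : ℕ}

theorem coe_filter_minimalPeriod (hfin : (ptsOfPeriod T L).Finite) {d : ℕ}
    (hd : d ∣ L) :
    (hfin.toFinset.filter (fun f => minimalPeriod T f = d) : Set S) =
      {f | minimalPeriod T f = d} := by
  ext f
  simp only [Finset.coe_filter, Set.Finite.mem_toFinset, mem_ptsOfPeriod, Set.mem_ofPred_eq,
    and_iff_right_iff_imp]
  rintro rfl
  exact isPeriodicPt_iff_minimalPeriod_dvd.2 hd

theorem ncard_ptsOfPeriod_eq_sum (hL : L ≠ 0) (hfin : (ptsOfPeriod T L).Finite) :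
    (ptsOfPeriod T L).ncard = ∑ d ∈ L.divisors, {f | minimalPeriod T f = d}.ncard := by
  rw [Set.ncard_eq_toFinset_card _ hfin,
    Finset.card_eq_sum_card_fiberwise (f := minimalPeriod T) (t := L.divisors)]
  · refine Finset.sum_congr rfl fun d hd => ?_
    rw [← coe_filter_minimalPeriod hfin (Nat.dvd_of_mem_divisors hd), Set.ncard_coe_finset]
  · intro f hf
    have hf' : IsPeriodicPt T L f := by simpa using hf
    simpa [hL] using hf'.minimalPeriod_dvd

theorem minimalPeriod_iterate_eq (hL : L ≠ 0) {f : S} (hf : f ∈ ptsOfPeriod T L) (k : ℕ) :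
    minimalPeriod T (T^[k] f) = minimalPeriod T f :=
  minimalPeriod_apply_iterate ⟨L, Nat.pos_of_ne_zero hL, hf⟩ k

/-- The fibres of `q` over this image are the orbits of minimal period `d`, and each has exactly `d`
points. -/
theorem mul_ncard_image_minimalPeriod (hL : L ≠ 0) (hfin : (ptsOfPeriod T L).Finite) {q : S → Q}
    (hq : ∀ f ∈ ptsOfPeriod T L, ∀ g ∈ ptsOfPeriod T L, q f = q g ↔ ∃ k, T^[k] f = g) {d : ℕ}
    (hd : d ∣ L) :
    d * (q '' {f | minimalPeriod T f = d}).ncard = {f | minimalPeriod T f = d}.ncard := by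
  classical
  have hd0 : 0 < d := Nat.pos_of_dvd_of_pos hd (Nat.pos_of_ne_zero hL)
  rw [← coe_filter_minimalPeriod hfin hd, ← Finset.coe_image, Set.ncard_coe_finset,
    Set.ncard_coe_finset]
  set s := hfin.toFinset.filter (fun f => minimalPeriod T f = d) with hs
  rw [Finset.card_eq_sum_card_fiberwise (s := s) (f := q) (t := s.image q)
    (fun f hf => Finset.mem_image_of_mem q hf), Finset.sum_const_nat (m := d), mul_comm]
  intro c hc
  obtain ⟨f, hf, rfl⟩ := Finset.mem_image.1 hc
  obtain ⟨hfL, hfd⟩ : f ∈ ptsOfPeriod T L ∧ minimalPeriod T f = d := by simpa [hs] using hf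
  have himg : s.filter (fun g => q g = q f) = (Finset.range d).image (fun k => T^[k] f) := by
    ext g
    simp only [hs, Finset.mem_filter, Set.Finite.mem_toFinset, Finset.mem_image, Finset.mem_range]
    constructor
    · rintro ⟨⟨hg, -⟩, hqg⟩
      obtain ⟨k, rfl⟩ := (hq f hfL g hg).1 hqg.symm
      exact ⟨k % d, Nat.mod_lt _ hd0, by rw [← hfd, iterate_mod_minimalPeriod_eq]⟩
    · rintro ⟨k, -, rfl⟩
      have hk : T^[k] f ∈ ptsOfPeriod T L := IsPeriodicPt.apply_iterate hfL k
      exact ⟨⟨hk, by rw [minimalPeriod_iterate_eq hL hfL, hfd]⟩, ((hq f hfL _ hk).2 ⟨k, rfl⟩).symm⟩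
  rw [himg, Finset.card_image_of_injOn, Finset.card_range]
  intro k hk l hl h
  rw [Finset.coe_range, ← hfd] at hk hl
  exact iterate_injOn_Iio_minimalPeriod hk hl h

theorem ncard_image_ptsOfPeriod_eq_sum (hL : L ≠ 0) (hfin : (ptsOfPeriod T L).Finite) {q : S → Q}
    (hq : ∀ f ∈ ptsOfPeriod T L, ∀ g ∈ ptsOfPeriod T L, q f = q g ↔ ∃ k, T^[k] f = g) :
    (q '' ptsOfPeriod T L).ncard =
      ∑ d ∈ L.divisors, (q '' {f | minimalPeriod T f = d}).ncard := by
  classical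
  have hu : hfin.toFinset.image q = L.divisors.biUnion
      (fun d => (hfin.toFinset.filter (fun f => minimalPeriod T f = d)).image q) := by
    rw [← Finset.biUnion_image, Finset.biUnion_filter_eq_of_maps_to]
    intro f hf
    have hf' : IsPeriodicPt T L f := by simpa using hf
    simpa [hL] using hf'.minimalPeriod_dvd
  have h1 : (q '' ptsOfPeriod T L).ncard = (hfin.toFinset.image q).card := by
    rw [← Set.ncard_coe_finset, Finset.coe_image, hfin.coe_toFinset]
  rw [h1, hu, Finset.card_biUnion]
  · refine Finset.sum_congr rfl fun d hd => ?_
    rw [← coe_filter_minimalPeriod hfin (Nat.dvd_of_mem_divisors hd), ← Finset.coe_image,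
      Set.ncard_coe_finset]
  · intro d _ e _ hde
    rw [Function.onFun, Finset.disjoint_left]
    intro c hc hc'
    obtain ⟨f, hf, rfl⟩ := Finset.mem_image.1 hc
    obtain ⟨g, hg, hgf⟩ := Finset.mem_image.1 hc'
    simp only [Finset.mem_filter, Set.Finite.mem_toFinset] at hf hg
    obtain ⟨k, rfl⟩ := (hq f hf.1 g hg.1).1 hgf.symm
    rw [minimalPeriod_iterate_eq hL hf.1] at hg
    exact hde (hf.2.symm.trans hg.2)

end Orbits

/-! ### Möbius and totient sums over divisors. -/

section DivisorSums

open ArithmeticFunction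

theorem sum_moebius_mul_eq {N P : ℕ → ℚ} (h : ∀ n, n ≠ 0 → N n = ∑ d ∈ n.divisors, P d) {L : ℕ}
    (hL : L ≠ 0) : ∑ d ∈ L.divisors, (moebius d : ℚ) * N (L / d) = P L := by
  have := (sum_eq_iff_sum_mul_moebius_eq (f := P) (g := N)).1
    (fun n hn => (h n hn.ne').symm) L (Nat.pos_of_ne_zero hL)
  rw [← this, Nat.sum_divisorsAntidiagonal (f := fun i j => (moebius i : ℚ) * N j)]

/-- In Dirichlet convolution `N = ζ * P` and `φ * ζ = id`, whence `φ * N = id * P`. -/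
theorem sum_totient_mul_eq {N P : ℕ → ℚ} (h : ∀ n, n ≠ 0 → N n = ∑ d ∈ n.divisors, P d) (L : ℕ) :
    ∑ d ∈ L.divisors, (Nat.totient d : ℚ) * N (L / d) = L * ∑ d ∈ L.divisors, P d / d := by
  let φ' : ArithmeticFunction ℚ := ⟨fun n => Nat.totient n, by simp⟩
  let P' : ArithmeticFunction ℚ := ⟨fun n => if n = 0 then 0 else P n, by simp⟩
  let I' : ArithmeticFunction ℚ := ⟨fun n => n, by simp⟩
  have h1 : φ' * (zeta : ArithmeticFunction ℚ) = I' := by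
    ext n
    rw [coe_mul_zeta_apply]
    change ∑ d ∈ n.divisors, (Nat.totient d : ℚ) = n
    exact_mod_cast Nat.sum_totient n
  have h2 : (φ' * (zeta : ArithmeticFunction ℚ) * P') L = (P' * I') L := by
    rw [h1, mul_comm]
  rw [mul_assoc, mul_apply, mul_apply,
    Nat.sum_divisorsAntidiagonal (f := fun i j => φ' i * ((zeta : ArithmeticFunction ℚ) * P') j),
    Nat.sum_divisorsAntidiagonal (f := fun i j => P' i * I' j)] at h2
  rw [Finset.mul_sum]
  convert h2 using 1
  · refine Finset.sum_congr rfl fun d hd => ?_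
    have hd0 : L / d ≠ 0 := (Nat.div_pos (Nat.divisor_le hd) (Nat.pos_of_mem_divisors hd)).ne'
    rw [coe_zeta_mul_apply, h _ hd0]
    congr 1
    refine Finset.sum_congr rfl fun e he => ?_
    exact (if_neg (Nat.pos_of_mem_divisors he).ne').symm
  · refine Finset.sum_congr rfl fun d hd => ?_
    have hd0 : d ≠ 0 := (Nat.pos_of_mem_divisors hd).ne'
    change _ = (if d = 0 then 0 else P d) * ((L / d : ℕ) : ℚ)
    rw [if_neg hd0, Nat.cast_div (Nat.dvd_of_mem_divisors hd) (by exact_mod_cast hd0)]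
    ring

theorem neg_one_pow_eq_two_mul_ite_sub_one (n : ℕ) :
    (-1 : ℚ) ^ n = 2 * (if 2 ∣ n then 1 else 0) - 1 := by
  rcases Nat.even_or_odd n with h | h
  · rw [h.neg_one_pow, if_pos h.two_dvd]
    norm_num
  · rw [h.neg_one_pow, if_neg (by rwa [← even_iff_two_dvd, Nat.not_even_iff_odd])]
    norm_num

theorem sum_divisors_ite_two_dvd (F : ℕ → ℚ) {L : ℕ} (hL : L ≠ 0) :
    ∑ d ∈ L.divisors, F d * (if 2 ∣ L / d then 1 else 0) =
      if 2 ∣ L then ∑ d ∈ (L / 2).divisors, F d else 0 := by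
  simp only [mul_ite, mul_one, mul_zero]
  rw [← Finset.sum_filter]
  split_ifs with h
  · refine Finset.sum_congr ?_ fun _ _ => rfl
    obtain ⟨m, rfl⟩ := h
    ext d
    simp only [Finset.mem_filter, Nat.mem_divisors]
    rw [Nat.mul_div_cancel_left _ two_pos]
    constructor
    · rintro ⟨⟨⟨k, hk⟩, -⟩, h2⟩
      have hd : 0 < d := Nat.pos_of_ne_zero (by rintro rfl; omega)
      rw [hk, Nat.mul_div_cancel_left _ hd] at h2
      obtain ⟨j, rfl⟩ := h2
      refine ⟨⟨j, by linarith⟩, by omega⟩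
    · rintro ⟨⟨k, rfl⟩, hm⟩
      have hd : 0 < d := Nat.pos_of_ne_zero (by rintro rfl; simp at hm)
      refine ⟨⟨⟨2 * k, by ring⟩, hL⟩, ?_⟩
      rw [show 2 * (d * k) = d * (2 * k) by ring, Nat.mul_div_cancel_left _ hd]
      exact dvd_mul_right 2 k
  · rw [Finset.filter_false_of_mem, Finset.sum_empty]
    intro d hd h2
    exact h (h2.trans (Nat.div_dvd_of_dvd (Nat.dvd_of_mem_divisors hd)))

/-- Here `2 + (-1) ^ n` is `1`, plus `2` when `n` is even; and `L / d` is even exactly when `L` is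
even and `d` divides `L / 2`. -/
theorem sum_mul_closed_form (F : ℕ → ℚ) {L : ℕ} (hL : L ≠ 0) :
    ∑ d ∈ L.divisors, F d * ((3 : ℚ) ^ (L / d) + 2 + (-1) ^ (L / d)) =
      ∑ d ∈ L.divisors, F d * 3 ^ (L / d) + ∑ d ∈ L.divisors, F d +
        2 * (if 2 ∣ L then ∑ d ∈ (L / 2).divisors, F d else 0) := by
  rw [← sum_divisors_ite_two_dvd F hL, Finset.mul_sum, ← Finset.sum_add_distrib,
    ← Finset.sum_add_distrib]
  refine Finset.sum_congr rfl fun d _ => ?_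
  rw [neg_one_pow_eq_two_mul_ite_sub_one]
  ring

theorem sum_totient_mul_closed_form {L : ℕ} (hL : L ≠ 0) :
    ∑ d ∈ L.divisors, (Nat.totient d : ℚ) * ((3 : ℚ) ^ (L / d) + 2 + (-1) ^ (L / d)) =
      ∑ d ∈ L.divisors, (Nat.totient d : ℚ) * 3 ^ (L / d) + L * ((3 + (-1) ^ L) / 2) := by
  have h (n : ℕ) : ∑ d ∈ n.divisors, (Nat.totient d : ℚ) = n := by
    exact_mod_cast Nat.sum_totient n
  rw [sum_mul_closed_form _ hL, h, h, neg_one_pow_eq_two_mul_ite_sub_one]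
  split_ifs with h2
  · rw [Nat.cast_div h2 (by norm_num)]
    push_cast
    ring
  · ring

theorem sum_moebius_mul_closed_form {L : ℕ} (hL : 3 ≤ L) :
    ∑ d ∈ L.divisors, (moebius d : ℚ) * ((3 : ℚ) ^ (L / d) + 2 + (-1) ^ (L / d)) =
      ∑ d ∈ L.divisors, (moebius d : ℚ) * 3 ^ (L / d) := by
  have h (n : ℕ) (hn : n ≠ 1) : ∑ d ∈ n.divisors, (moebius d : ℚ) = 0 := by
    have : ((moebius : ArithmeticFunction ℚ) * (zeta : ArithmeticFunction ℚ)) n =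
        (1 : ArithmeticFunction ℚ) n := by rw [coe_moebius_mul_coe_zeta]
    rwa [coe_mul_zeta_apply, one_apply_ne hn] at this
  -- The divisor sum of `μ` vanishes except at `1`, so the corrections vanish as soon as `L` and `L
  -- / 2` both differ from `1`. This is why lengths `1` and `2` are exceptional.
  rw [sum_mul_closed_form _ (by omega), h _ (by omega)]
  split_ifs with h2
  · rw [h _ (by omega)]
    simp
  · simp

end DivisorSums

/-! ### Orbit counts from numbers of periodic points. -/

section OrbitCount

open Function ArithmeticFunction

variable {S Q : Type*} {T : S → S}

theorem mul_ncard_image_minimalPeriod_eq_sum_moebius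
    (hfin : ∀ n, n ≠ 0 → (ptsOfPeriod T n).Finite) {N : ℕ → ℚ}
    (hN : ∀ n, n ≠ 0 → ((ptsOfPeriod T n).ncard : ℚ) = N n) {L : ℕ} (hL : L ≠ 0) {q : S → Q}
    (hq : ∀ f ∈ ptsOfPeriod T L, ∀ g ∈ ptsOfPeriod T L, q f = q g ↔ ∃ k, T^[k] f = g) :
    (L : ℚ) * (q '' {f | minimalPeriod T f = L}).ncard =
      ∑ d ∈ L.divisors, (moebius d : ℚ) * N (L / d) := by
  rw [sum_moebius_mul_eq (P := fun d => ({f | minimalPeriod T f = d}.ncard : ℚ)) _ hL,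
    ← mul_ncard_image_minimalPeriod hL (hfin L hL) hq dvd_rfl, Nat.cast_mul]
  intro n hn
  rw [← hN n hn, ncard_ptsOfPeriod_eq_sum hn (hfin n hn), Nat.cast_sum]

theorem mul_ncard_image_ptsOfPeriod_eq_sum_totient
    (hfin : ∀ n, n ≠ 0 → (ptsOfPeriod T n).Finite) {N : ℕ → ℚ}
    (hN : ∀ n, n ≠ 0 → ((ptsOfPeriod T n).ncard : ℚ) = N n) {L : ℕ} (hL : L ≠ 0) {q : S → Q}
    (hq : ∀ f ∈ ptsOfPeriod T L, ∀ g ∈ ptsOfPeriod T L, q f = q g ↔ ∃ k, T^[k] f = g) :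
    (L : ℚ) * (q '' ptsOfPeriod T L).ncard =
      ∑ d ∈ L.divisors, (Nat.totient d : ℚ) * N (L / d) := by
  rw [sum_totient_mul_eq (P := fun d => ({f | minimalPeriod T f = d}.ncard : ℚ)),
    ncard_image_ptsOfPeriod_eq_sum hL (hfin L hL) hq, Nat.cast_sum]
  · congr 1
    refine Finset.sum_congr rfl fun d hd => ?_
    have hd0 : (d : ℚ) ≠ 0 := by exact_mod_cast (Nat.pos_of_mem_divisors hd).ne'
    rw [← mul_ncard_image_minimalPeriod hL (hfin L hL) hq (Nat.dvd_of_mem_divisors hd),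
      Nat.cast_mul, mul_div_cancel_left₀ _ hd0]
  · intro n hn
    rw [← hN n hn, ncard_ptsOfPeriod_eq_sum hn (hfin n hn), Nat.cast_sum]

end OrbitCount

/-! ### Cyclically reduced words as periodic points of a shift. -/

open Function

/-- One-sided infinite reduced words in the free group over `α`. -/
def ReducedSeq (α : Type*) : Type _ :=
  {f : ℕ → α × Bool // ∀ i, (f i).1 = (f (i + 1)).1 → (f i).2 = (f (i + 1)).2}

namespace ReducedSeq

variable {α : Type*}

/-- The shift, which deletes the first letter. -/
def shift (f : ReducedSeq α) : ReducedSeq α :=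
  ⟨fun i => f.1 (i + 1), fun i => f.2 (i + 1)⟩

/-- The word of the first `n` letters. -/
def word (f : ReducedSeq α) (n : ℕ) : List (α × Bool) :=
  (List.range n).map f.1

@[simp]
theorem length_word (f : ReducedSeq α) (n : ℕ) : (f.word n).length = n := by simp [word]

theorem getElem_word (f : ReducedSeq α) {n i : ℕ} (h : i < (f.word n).length) :
    (f.word n)[i] = f.1 i := by simp [word]

theorem shift_iterate_apply (f : ReducedSeq α) (k i : ℕ) : (shift^[k] f).1 i = f.1 (i + k) := by
  induction k generalizing i with
  | zero => rfl
  | succ k ih =>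
    rw [iterate_succ_apply']
    change (shift^[k] f).1 (i + 1) = _
    rw [ih, add_assoc, add_comm 1 k]

theorem isPeriodicPt_shift_iff {f : ReducedSeq α} {n : ℕ} :
    IsPeriodicPt shift n f ↔ Periodic f.1 n := by
  refine ⟨fun h i => ?_, fun h => Subtype.ext (funext fun i => ?_)⟩
  · rw [← shift_iterate_apply, h.eq]
  · rw [shift_iterate_apply, h]

theorem isCyclicallyReduced_word {f : ReducedSeq α} {n : ℕ} (hf : f ∈ ptsOfPeriod shift n) :
    FreeGroup.IsCyclicallyReduced (f.word n) := by
  rcases n with _ | n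
  · exact FreeGroup.IsCyclicallyReduced.nil
  refine ⟨List.isChain_iff_getElem.2 fun i hi => ?_, fun a ha b hb => ?_⟩
  · rw [getElem_word, getElem_word]
    exact f.2 i
  · have ha' : f.1 n = a := by simpa [word, List.range_succ] using ha
    have hb' : f.1 0 = b := by simpa [word, List.range_succ_eq_map] using hb
    rw [← ha', ← hb', ← isPeriodicPt_shift_iff.1 hf 0, zero_add]
    exact f.2 n

theorem exists_word_eq {u : List (α × Bool)} (hu : FreeGroup.IsCyclicallyReduced u) (h : u ≠ []) :
    ∃ f ∈ ptsOfPeriod (shift (α := α)) u.length, f.word u.length = u := by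
  have hpos : 0 < u.length := List.length_pos_iff.2 h
  have hlt (i : ℕ) : i % u.length < u.length := Nat.mod_lt _ hpos
  have hred (i : ℕ) : (u[i % u.length]'(hlt i)).1 = (u[(i + 1) % u.length]'(hlt (i + 1))).1 →
      (u[i % u.length]'(hlt i)).2 = (u[(i + 1) % u.length]'(hlt (i + 1))).2 := by
    by_cases hi : i % u.length + 1 < u.length
    · have : (i + 1) % u.length = i % u.length + 1 := by
        rw [← Nat.mod_add_mod, Nat.mod_eq_of_lt hi]
      simp only [this]
      exact hu.isReduced.getElem hi
    · have hi' : i % u.length = u.length - 1 := by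
        have := Nat.mod_lt i hpos
        omega
      have : (i + 1) % u.length = 0 := by
        rw [← Nat.mod_add_mod, hi', Nat.sub_add_cancel hpos, Nat.mod_self]
      simp only [this, hi']
      refine (FreeGroup.isCyclicallyReduced_iff.1 hu).2 _ ?_ _ ?_
      · simp [List.getLast?_eq_getElem?, hpos]
      · simp [List.head?_eq_getElem?, hpos]
  let f : ReducedSeq α := ⟨fun i => u[i % u.length]'(hlt i), hred⟩
  refine ⟨f, isPeriodicPt_shift_iff.2 fun i => by simp [f], ?_⟩
  refine List.ext_getElem (by simp) fun i h1 h2 => ?_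
  rw [getElem_word]
  simp [f, Nat.mod_eq_of_lt h2]

theorem word_rotate {f : ReducedSeq α} {n : ℕ} (hf : f ∈ ptsOfPeriod shift n) (k : ℕ) :
    (f.word n).rotate k = (shift^[k] f).word n := by
  refine List.ext_getElem (by simp) fun i h1 h2 => ?_
  rw [List.getElem_rotate, getElem_word, getElem_word, shift_iterate_apply, length_word]
  exact (isPeriodicPt_shift_iff.1 hf).map_mod_nat _

theorem eq_of_word_eq {f g : ReducedSeq α} {n : ℕ} (hn : n ≠ 0) (hf : f ∈ ptsOfPeriod shift n)
    (hg : g ∈ ptsOfPeriod shift n) (h : f.word n = g.word n) : f = g := by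
  refine Subtype.ext (funext fun i => ?_)
  rw [← (isPeriodicPt_shift_iff.1 hf).map_mod_nat, ← (isPeriodicPt_shift_iff.1 hg).map_mod_nat]
  have hi : i % n < n := Nat.mod_lt _ (Nat.pos_of_ne_zero hn)
  rw [← getElem_word f (n := n) (by simpa using hi), ← getElem_word g (n := n) (by simpa using hi)]
  simp only [h]

theorem isRotated_word_iff {f g : ReducedSeq α} {n : ℕ} (hn : n ≠ 0)
    (hf : f ∈ ptsOfPeriod shift n) (hg : g ∈ ptsOfPeriod shift n) :
    f.word n ~r g.word n ↔ ∃ k, shift^[k] f = g := by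
  refine exists_congr fun k => ?_
  rw [word_rotate hf]
  exact ⟨eq_of_word_eq hn (IsPeriodicPt.apply_iterate hf k) hg, fun h => by rw [h]⟩

/-- The element of the free group given by the first `n` letters. -/
def value (f : ReducedSeq α) (n : ℕ) : FreeGroup α :=
  FreeGroup.mk (f.word n)

theorem isConj_value_iff {f g : ReducedSeq α} {n : ℕ} (hn : n ≠ 0)
    (hf : f ∈ ptsOfPeriod shift n) (hg : g ∈ ptsOfPeriod shift n) :
    IsConj (f.value n) (g.value n) ↔ ∃ k, shift^[k] f = g :=
  ((isCyclicallyReduced_word hf).isConj_mk_iff (isCyclicallyReduced_word hg)).trans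
    (isRotated_word_iff hn hf hg)

theorem value_mul {f : ReducedSeq α} {n : ℕ} (hf : f ∈ ptsOfPeriod shift n) (k : ℕ) :
    f.value (n * k) = f.value n ^ k := by
  induction k with
  | zero => rfl
  | succ k ih =>
    have h : f.word (n * (k + 1)) = f.word (n * k) ++ f.word n := by
      rw [mul_add, mul_one, word, List.range_add, List.map_append, List.map_map]
      refine congrArg₂ _ rfl (List.map_congr_left fun i _ => ?_)
      have hp : Periodic f.1 (n * k) :=
        isPeriodicPt_shift_iff.1 (IsPeriodicPt.mul_const hf k)
      rw [comp_apply, add_comm, hp]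
    rw [pow_succ, ← ih, value, h, FreeGroup.mk_append]
    rfl

/-- Up to conjugacy a root is given by a cyclically reduced word `u`, and its power by the periodic
repetition of `u`. Conjugate words are rotations, so `f` has the period `u.length`, a proper divisor
of `n`. Conversely, a shorter minimal period exhibits the word as a power. -/
theorem exists_isConj_pow_iff {f : ReducedSeq α} {n : ℕ} (hn : n ≠ 0)
    (hf : f ∈ ptsOfPeriod shift n) :
    (∃ (h : FreeGroup α) (m : ℕ), 2 ≤ m ∧ IsConj (f.value n) (h ^ m)) ↔
      minimalPeriod shift f ≠ n := by
  constructor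
  · rintro ⟨h, m, hm, hc⟩ hmin
    obtain ⟨u, hu, hhu⟩ := FreeGroup.exists_isCyclicallyReduced_isConj h
    have hfr := isCyclicallyReduced_word hf
    have hc' : IsConj (f.value n) (FreeGroup.mk u ^ m) := by
      obtain ⟨c, hc1⟩ := isConj_iff.1 hhu
      refine hc.trans (isConj_iff.2 ⟨c, ?_⟩)
      rw [← hc1, conj_pow]
    by_cases hnil : u = []
    · subst hnil
      rw [← FreeGroup.one_eq_mk, one_pow, isConj_one_left, value, FreeGroup.one_eq_mk] at hc'
      have := hfr.isReduced.eq_of_mk_eq FreeGroup.IsReduced.nil hc'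
      exact hn (by simpa using congrArg List.length this)
    · obtain ⟨g, hg, hgu⟩ := exists_word_eq hu hnil
      set d := u.length with hd
      have hd0 : 0 < d := List.length_pos_iff.2 hnil
      have hgm : g ∈ ptsOfPeriod shift (d * m) := IsPeriodicPt.mul_const hg m
      have hc2 : IsConj (f.value n) (g.value (d * m)) := by
        rw [value_mul hg, value, value, hgu]
        exact hc'
      have hr := (hfr.isConj_mk_iff (isCyclicallyReduced_word hgm)).1 hc2
      have hlen : n = d * m := by simpa using hr.perm.length_eq
      rw [← hlen] at hgm hc2
      obtain ⟨k, rfl⟩ := (isConj_value_iff hn hf hgm).1 hc2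
      rw [mem_ptsOfPeriod, isPeriodicPt_iff_minimalPeriod_dvd, minimalPeriod_iterate_eq hn hf,
        hmin] at hg
      have := Nat.le_of_dvd hd0 hg
      nlinarith
  · intro hne
    set d := minimalPeriod shift f with hd
    obtain ⟨m, hm⟩ : d ∣ n := isPeriodicPt_iff_minimalPeriod_dvd.1 hf
    refine ⟨f.value d, m, ?_, ?_⟩
    · rcases m with _ | _ | m
      · simp [hn] at hm
      · exact absurd (by simpa using hm.symm) hne
      · omega
    · rw [hm, value_mul (isPeriodicPt_minimalPeriod shift f)]

end ReducedSeq

/-! ### Counting reduced walks and periodic sequences. -/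

/-- The walks of `n` steps from `s` to `t` on the letters of the free group of rank two in which no
letter is followed by its inverse. -/
def reducedWalks (n : ℕ) (s t : Fin 2 × Bool) : Finset (Fin (n + 1) → Fin 2 × Bool) :=
  Finset.univ.filter fun v => v 0 = s ∧ v (Fin.last n) = t ∧
    ∀ i : Fin n, (v i.castSucc).1 = (v i.succ).1 → (v i.castSucc).2 = (v i.succ).2

theorem mem_reducedWalks {n : ℕ} {s t : Fin 2 × Bool} {v : Fin (n + 1) → Fin 2 × Bool} :
    v ∈ reducedWalks n s t ↔ v 0 = s ∧ v (Fin.last n) = t ∧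
      ∀ i : Fin n, (v i.castSucc).1 = (v i.succ).1 → (v i.castSucc).2 = (v i.succ).2 := by
  simp [reducedWalks]

theorem card_reducedWalks_zero (s t : Fin 2 × Bool) :
    (reducedWalks 0 s t).card = if s = t then 1 else 0 := by
  split_ifs with h
  · rw [Finset.card_eq_one]
    refine ⟨fun _ => s, Finset.ext fun v => ?_⟩
    rw [mem_reducedWalks, Finset.mem_singleton, ← h]
    constructor
    · rintro ⟨h0, -⟩
      funext i
      rw [show i = 0 from Fin.ext (by omega), h0]
    · rintro rfl
      exact ⟨rfl, rfl, fun i => i.elim0⟩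
  · rw [Finset.card_eq_zero, Finset.eq_empty_iff_forall_notMem]
    intro v hv
    rw [mem_reducedWalks] at hv
    exact h (hv.1.symm.trans hv.2.1)

theorem card_reducedWalks_succ (n : ℕ) (s t : Fin 2 × Bool) :
    (reducedWalks (n + 1) s t).card =
      ∑ u, if s.1 = u.1 → s.2 = u.2 then (reducedWalks n u t).card else 0 := by
  rw [Finset.card_eq_sum_card_fiberwise (f := fun v => v 1) (t := Finset.univ)
    (fun _ _ => Finset.mem_coe.2 (Finset.mem_univ _))]
  refine Finset.sum_congr rfl fun u _ => ?_
  split_ifs with h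
  · refine Finset.card_nbij' (fun v => Fin.tail v) (fun v => Fin.cons s v) ?_ ?_ ?_ ?_
    · intro v hv
      simp only [Finset.coe_filter, Set.mem_ofPred_eq, mem_reducedWalks] at hv
      obtain ⟨⟨h0, h1, h2⟩, h3⟩ := hv
      exact mem_reducedWalks.2 ⟨h3, h1, fun i => h2 i.succ⟩
    · intro v hv
      obtain ⟨h0, h1, h2⟩ := mem_reducedWalks.1 (Finset.mem_coe.1 hv)
      simp only [Finset.coe_filter, Set.mem_ofPred_eq, mem_reducedWalks]
      refine ⟨⟨rfl, h1, fun i => ?_⟩, h0⟩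
      refine Fin.cases ?_ (fun i => ?_) i
      · change s.1 = (v 0).1 → s.2 = (v 0).2
        rwa [h0]
      · exact h2 i
    · intro v hv
      simp only [Finset.coe_filter, Set.mem_ofPred_eq, mem_reducedWalks] at hv
      rw [← hv.1.1]
      exact Fin.cons_self_tail v
    · intro v _
      exact Fin.tail_cons _ _
  · rw [Finset.card_eq_zero, Finset.eq_empty_iff_forall_notMem]
    intro v hv
    rw [Finset.mem_filter, mem_reducedWalks] at hv
    obtain ⟨⟨h0, -, h2⟩, rfl⟩ := hv
    exact h (h0 ▸ h2 0)

/-- The transition matrix is `A = J - P`, with `J` the all-ones matrix and `P` the involution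
exchanging each letter with its inverse. Since `PJ = JP = J` and `J² = 4J`, one gets `4 Aⁿ = (3ⁿ -
(-1)ⁿ) J + 4 (-P)ⁿ`, which is the formula entry by entry. -/
theorem four_mul_card_reducedWalks (n : ℕ) (s t : Fin 2 × Bool) :
    4 * ((reducedWalks n s t).card : ℚ) = 3 ^ n - (-1) ^ n +
      4 * if Even n then (if s = t then 1 else 0) else (if s = (t.1, !t.2) then -1 else 0) := by
  induction n generalizing s with
  | zero => simp [card_reducedWalks_zero]
  | succ n ih =>
    rw [card_reducedWalks_succ, Nat.cast_sum, Finset.mul_sum]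
    have h (u : Fin 2 × Bool) : 4 * ((if s.1 = u.1 → s.2 = u.2 then
        (reducedWalks n u t).card else 0 : ℕ) : ℚ) = if s.1 = u.1 → s.2 = u.2 then
          (3 ^ n - (-1) ^ n + 4 * if Even n then (if u = t then 1 else 0) else
            (if u = (t.1, !t.2) then -1 else 0)) else 0 := by
      by_cases hr : s.1 = u.1 → s.2 = u.2
      · rw [if_pos hr, if_pos hr]
        exact ih u
      · rw [if_neg hr, if_neg hr, Nat.cast_zero, mul_zero]
    rw [Finset.sum_congr rfl fun u _ => h u, Fintype.sum_prod_type, Fin.sum_univ_two,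
      Fintype.sum_bool, Fintype.sum_bool]
    obtain ⟨s, bs⟩ := s
    obtain ⟨t, bt⟩ := t
    rcases Nat.even_or_odd n with hn | hn
    · have hn' : ¬ Even (n + 1) := by simpa [Nat.even_add_one] using hn
      fin_cases s <;> fin_cases t <;> cases bs <;> cases bt <;>
        simp [hn, hn', pow_succ] <;> ring
    · have hn' : Even (n + 1) := hn.add_one
      have hn2 : ¬ Even n := Nat.not_even_iff_odd.2 hn
      fin_cases s <;> fin_cases t <;> cases bs <;> cases bt <;>
        simp [hn2, hn', hn.neg_one_pow, pow_succ] <;> ring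

/-- The closed reduced walks of `n` steps. -/
def closedReducedWalks (n : ℕ) : Finset (Fin (n + 1) → Fin 2 × Bool) :=
  Finset.univ.filter fun v => v (Fin.last n) = v 0 ∧
    ∀ i : Fin n, (v i.castSucc).1 = (v i.succ).1 → (v i.castSucc).2 = (v i.succ).2

/-- This is the trace of `Aⁿ`. The term `(-P)ⁿ` contributes `4` for even `n` and `0` for odd `n`, as
no letter is its own inverse. -/
theorem card_closedReducedWalks (n : ℕ) :
    ((closedReducedWalks n).card : ℚ) = 3 ^ n + 2 + (-1) ^ n := by
  have h : (closedReducedWalks n).card = ∑ s, (reducedWalks n s s).card := by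
    rw [Finset.card_eq_sum_card_fiberwise (f := fun v => v 0) (t := Finset.univ)
      (fun _ _ => Finset.mem_coe.2 (Finset.mem_univ _))]
    refine Finset.sum_congr rfl fun s _ => congrArg _ (Finset.ext fun v => ?_)
    rw [mem_reducedWalks, Finset.mem_filter, closedReducedWalks, Finset.mem_filter]
    constructor
    · rintro ⟨⟨-, h1, h2⟩, rfl⟩
      exact ⟨rfl, h1, h2⟩
    · rintro ⟨rfl, h1, h2⟩
      exact ⟨⟨Finset.mem_univ _, h1, h2⟩, rfl⟩
  have h4 : 4 * ((closedReducedWalks n).card : ℚ) = 4 * (3 ^ n + 2 + (-1) ^ n) := by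
    rw [h, Nat.cast_sum, Finset.mul_sum,
      Finset.sum_congr rfl fun s _ => four_mul_card_reducedWalks n s s]
    rcases Nat.even_or_odd n with hn | hn
    · simp [hn, hn.neg_one_pow]
      ring
    · have hn2 : ¬ Even n := Nat.not_even_iff_odd.2 hn
      simp [hn2, hn.neg_one_pow, Prod.ext_iff]
      ring
  linarith

namespace ReducedSeq

/-- The first `n + 1` letters. -/
def initial (n : ℕ) (f : ReducedSeq (Fin 2)) : Fin (n + 1) → Fin 2 × Bool := fun i => f.1 i

theorem injOn_initial {n : ℕ} (hn : n ≠ 0) : Set.InjOn (initial n) (ptsOfPeriod shift n) := by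
  intro f hf g hg h
  refine eq_of_word_eq hn hf hg (List.map_congr_left fun i hi => ?_)
  exact congrFun h ⟨i, by have := List.mem_range.1 hi; omega⟩

theorem image_initial_ptsOfPeriod {n : ℕ} (hn : n ≠ 0) :
    initial n '' ptsOfPeriod shift n = closedReducedWalks n := by
  ext v
  simp only [closedReducedWalks, Finset.coe_filter, Finset.mem_univ, true_and, Set.mem_ofPred_eq]
  constructor
  · rintro ⟨f, hf, rfl⟩
    refine ⟨?_, fun i => f.2 i⟩
    have := isPeriodicPt_shift_iff.1 hf 0
    rwa [zero_add] at this
  · rintro ⟨h0, h⟩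
    have hlt (i : ℕ) : i % n < n := Nat.mod_lt _ (Nat.pos_of_ne_zero hn)
    -- A walk of `n` steps records `n + 1` letters, the last repeating the first; where the index
    -- wraps around, letter `n` may therefore stand for letter `0`.
    have hs (i : ℕ) : v ⟨(i + 1) % n, (hlt _).trans n.lt_succ_self⟩ =
        v ⟨i % n + 1, Nat.succ_lt_succ (hlt i)⟩ := by
      by_cases hi : i % n + 1 < n
      · congr 2
        rw [← Nat.mod_add_mod, Nat.mod_eq_of_lt hi]
      · have hi' : i % n + 1 = n := by have := hlt i; omega
        have h1 : (i + 1) % n = 0 := by rw [← Nat.mod_add_mod, hi', Nat.mod_self]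
        simp only [h1, hi']
        exact h0.symm
    refine ⟨⟨fun i => v ⟨i % n, (hlt i).trans n.lt_succ_self⟩, fun i => ?_⟩, ?_, ?_⟩
    · beta_reduce
      rw [hs]
      exact h ⟨i % n, hlt i⟩
    · exact isPeriodicPt_shift_iff.2 fun i => by simp
    · funext i
      change v ⟨i.1 % n, _⟩ = v i
      rcases Nat.lt_succ_iff_lt_or_eq.1 i.2 with hi | hi
      · congr 2
        exact Nat.mod_eq_of_lt hi
      · have : i = Fin.last n := Fin.ext hi
        subst this
        rw [h0]
        congr 2
        exact Nat.mod_self n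

theorem finite_ptsOfPeriod_shift (n : ℕ) (hn : n ≠ 0) :
    (ptsOfPeriod (shift (α := Fin 2)) n).Finite :=
  Set.Finite.of_finite_image (image_initial_ptsOfPeriod hn ▸ Finset.finite_toSet _)
    (injOn_initial hn)

theorem ncard_ptsOfPeriod_shift (n : ℕ) (hn : n ≠ 0) :
    ((ptsOfPeriod (shift (α := Fin 2)) n).ncard : ℚ) = 3 ^ n + 2 + (-1) ^ n := by
  rw [← card_closedReducedWalks, ← Set.ncard_coe_finset, ← image_initial_ptsOfPeriod hn,
    (injOn_initial hn).ncard_image]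

end ReducedSeq

/-! ### Free homotopy classes as shift orbits, and the final count. -/

namespace FreeHomotopyClass

variable {X : Type*} [TopologicalSpace X] {x : X} {a b : FundamentalGroup X x}

/-- The free homotopy class of the cyclic word given by the first `n` letters. -/
noncomputable def ofReducedSeq (a b : FundamentalGroup X x) (n : ℕ) (f : ReducedSeq (Fin 2)) :
    FreeHomotopyClass X :=
  ofFundamentalGroup (FreeGroup.lift ![a, b] (f.value n))

theorem setOf_hasWordLength_eq_image {L : ℕ} (hL : L ≠ 0) :
    {γ : FreeHomotopyClass X | γ.HasWordLength a b L} =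
      ofReducedSeq a b L '' ptsOfPeriod ReducedSeq.shift L := by
  ext γ
  constructor
  · rintro ⟨w, hw, rfl, hγ⟩
    obtain ⟨f, hf, hfw⟩ := ReducedSeq.exists_word_eq hw (List.length_pos_iff.1 (by omega))
    refine ⟨f, hf, ?_⟩
    rw [isRepresentedBy_iff.1 hγ, ofReducedSeq, ReducedSeq.value, hfw, wordValue]
  · rintro ⟨f, hf, rfl⟩
    exact ⟨f.word L, ReducedSeq.isCyclicallyReduced_word hf, f.length_word L,
      isRepresentedBy_iff.2 rfl⟩

theorem isConj_lift_iff (hbij : Bijective (FreeGroup.lift ![a, b])) {g h : FreeGroup (Fin 2)} :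
    IsConj (FreeGroup.lift ![a, b] g) (FreeGroup.lift ![a, b] h) ↔ IsConj g h := by
  refine ⟨fun hc => ?_, MonoidHom.map_isConj _⟩
  obtain ⟨c, hc⟩ := isConj_iff.1 hc
  obtain ⟨c, rfl⟩ := hbij.2 c
  exact isConj_iff.2 ⟨c, hbij.1 (by simpa using hc)⟩

theorem ofReducedSeq_eq_iff (hbij : Bijective (FreeGroup.lift ![a, b])) {L : ℕ} (hL : L ≠ 0)
    (f : ReducedSeq (Fin 2)) (hf : f ∈ ptsOfPeriod ReducedSeq.shift L) (g : ReducedSeq (Fin 2))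
    (hg : g ∈ ptsOfPeriod ReducedSeq.shift L) :
    ofReducedSeq a b L f = ofReducedSeq a b L g ↔ ∃ k, ReducedSeq.shift^[k] f = g := by
  rw [ofReducedSeq, ofReducedSeq, ofFundamentalGroup_eq_iff, isConj_lift_iff hbij,
    ReducedSeq.isConj_value_iff hL hf hg]

theorem ofReducedSeq_isPrimitive_iff (hbij : Bijective (FreeGroup.lift ![a, b])) {L : ℕ}
    (hL : L ≠ 0) {f : ReducedSeq (Fin 2)} (hf : f ∈ ptsOfPeriod ReducedSeq.shift L) :
    (ofReducedSeq a b L f).IsPrimitive ↔ minimalPeriod ReducedSeq.shift f = L := by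
  rw [ofReducedSeq, ofFundamentalGroup_isPrimitive_iff, not_iff_comm, ← ne_eq,
    ← ReducedSeq.exists_isConj_pow_iff hL hf]
  constructor
  · rintro ⟨h, n, hn, hc⟩
    exact ⟨FreeGroup.lift ![a, b] h, n, hn, by rwa [← map_pow, isConj_lift_iff hbij]⟩
  · rintro ⟨h, n, hn, hc⟩
    obtain ⟨h, rfl⟩ := hbij.2 h
    exact ⟨h, n, hn, by rwa [← map_pow, isConj_lift_iff hbij] at hc⟩

theorem setOf_isPrimitive_and_hasWordLength_eq_image (hbij : Bijective (FreeGroup.lift ![a, b]))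
    {L : ℕ} (hL : L ≠ 0) :
    {γ : FreeHomotopyClass X | γ.IsPrimitive ∧ γ.HasWordLength a b L} =
      ofReducedSeq a b L '' {f | minimalPeriod ReducedSeq.shift f = L} := by
  ext γ
  have h := Set.ext_iff.1 (setOf_hasWordLength_eq_image (a := a) (b := b) hL) γ
  constructor
  · rintro ⟨hp, hγ⟩
    obtain ⟨f, hf, rfl⟩ := h.1 hγ
    exact ⟨f, (ofReducedSeq_isPrimitive_iff hbij hL hf).1 hp, rfl⟩
  · rintro ⟨f, hfL, rfl⟩
    have hf : f ∈ ptsOfPeriod ReducedSeq.shift L :=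
      isPeriodicPt_iff_minimalPeriod_dvd.2 (dvd_of_eq hfL)
    exact ⟨(ofReducedSeq_isPrimitive_iff hbij hL hf).2 hfL, h.2 ⟨f, hf, rfl⟩⟩

theorem mul_ncard_isPrimitive_and_hasWordLength (hbij : Bijective (FreeGroup.lift ![a, b]))
    {L : ℕ} (hL : L ≠ 0) :
    (L : ℚ) * {γ : FreeHomotopyClass X | γ.IsPrimitive ∧ γ.HasWordLength a b L}.ncard =
      ∑ d ∈ L.divisors, (ArithmeticFunction.moebius d : ℚ) *
        ((3 : ℚ) ^ (L / d) + 2 + (-1) ^ (L / d)) := by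
  rw [setOf_isPrimitive_and_hasWordLength_eq_image hbij hL]
  exact mul_ncard_image_minimalPeriod_eq_sum_moebius
    ReducedSeq.finite_ptsOfPeriod_shift (N := fun n => 3 ^ n + 2 + (-1) ^ n)
    ReducedSeq.ncard_ptsOfPeriod_shift hL (ofReducedSeq_eq_iff hbij hL)

theorem mul_ncard_hasWordLength (hbij : Bijective (FreeGroup.lift ![a, b])) {L : ℕ}
    (hL : L ≠ 0) :
    (L : ℚ) * {γ : FreeHomotopyClass X | γ.HasWordLength a b L}.ncard =
      ∑ d ∈ L.divisors, (Nat.totient d : ℚ) * ((3 : ℚ) ^ (L / d) + 2 + (-1) ^ (L / d)) := by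
  rw [setOf_hasWordLength_eq_image hL]
  exact mul_ncard_image_ptsOfPeriod_eq_sum_totient
    ReducedSeq.finite_ptsOfPeriod_shift (N := fun n => 3 ^ n + 2 + (-1) ^ n)
    ReducedSeq.ncard_ptsOfPeriod_shift hL (ofReducedSeq_eq_iff hbij hL)

theorem finite_setOf_hasWordLength {L : ℕ} (hL : L ≠ 0) :
    {γ : FreeHomotopyClass X | γ.HasWordLength a b L}.Finite := by
  rw [setOf_hasWordLength_eq_image hL]
  exact (ReducedSeq.finite_ptsOfPeriod_shift L hL).image _

end FreeHomotopyClass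

theorem mainTheorem4 (x : PuncturedTorus) (a b : FundamentalGroup PuncturedTorus x)
    (hab : Subgroup.closure {a, b} = ⊤) :
    {γ : FreeHomotopyClass PuncturedTorus | γ.IsPrimitive ∧ γ.HasWordLength a b 1}.ncard = 4 ∧
    {γ : FreeHomotopyClass PuncturedTorus | γ.IsPrimitive ∧ γ.HasWordLength a b 2}.ncard = 4 ∧
    (∀ L : ℕ, 3 ≤ L →
      {γ : FreeHomotopyClass PuncturedTorus |
          γ.IsPrimitive ∧ γ.HasWordLength a b L}.Finite ∧
      ({γ : FreeHomotopyClass PuncturedTorus |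
          γ.IsPrimitive ∧ γ.HasWordLength a b L}.ncard : ℚ) =
        1 / (L : ℚ) *
          ∑ d ∈ L.divisors, (ArithmeticFunction.moebius d : ℚ) * (3 : ℚ) ^ (L / d)) ∧
    (∀ L : ℕ, 1 ≤ L →
      {γ : FreeHomotopyClass PuncturedTorus | γ.HasWordLength a b L}.Finite ∧
      ({γ : FreeHomotopyClass PuncturedTorus | γ.HasWordLength a b L}.ncard : ℚ) =
        1 / (L : ℚ) * ∑ d ∈ L.divisors, (Nat.totient d : ℚ) * (3 : ℚ) ^ (L / d) +
          (3 + (-1 : ℚ) ^ L) / 2) := by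
  obtain ⟨φ, hφ⟩ := PuncturedTorus.exists_surjective_fundamentalGroup_freeGroup x
  have hbij := FreeGroup.lift_bijective_of_closure_eq_top hab hφ
  refine ⟨?_, ?_, fun L hL => ⟨?_, ?_⟩, fun L hL => ⟨?_, ?_⟩⟩
  -- The Möbius sum is `3 + 2 - 1 = 4`.
  · have h := FreeHomotopyClass.mul_ncard_isPrimitive_and_hasWordLength hbij one_ne_zero
    norm_num at h
    exact_mod_cast h
  -- Twice the count is `(9 + 2 + 1) - (3 + 2 - 1) = 8`.
  · have h := FreeHomotopyClass.mul_ncard_isPrimitive_and_hasWordLength hbij two_ne_zero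
    rw [Nat.prime_two.sum_divisors, ArithmeticFunction.moebius_apply_prime Nat.prime_two] at h
    norm_num at h
    have h' : (({γ : FreeHomotopyClass PuncturedTorus |
        γ.IsPrimitive ∧ γ.HasWordLength a b 2}.ncard : ℕ) : ℚ) = 4 := by linarith
    exact_mod_cast h'
  · exact (FreeHomotopyClass.finite_setOf_hasWordLength (by omega)).subset fun γ hγ => hγ.2
  · have hL0 : (L : ℚ) ≠ 0 := by exact_mod_cast (by omega : L ≠ 0)
    rw [← sum_moebius_mul_closed_form hL,
      ← FreeHomotopyClass.mul_ncard_isPrimitive_and_hasWordLength hbij (by omega)]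
    field_simp
  · exact FreeHomotopyClass.finite_setOf_hasWordLength (by omega)
  · have hL0 : (L : ℚ) ≠ 0 := by exact_mod_cast (by omega : L ≠ 0)
    have h := FreeHomotopyClass.mul_ncard_hasWordLength hbij (L := L) (by omega)
    rw [sum_totient_mul_closed_form (by omega)] at h
    field_simp
    linarith
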